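/- Fix an integer $p\ge 3$, let $\lambda_p=2\cos(\pi/p)$, $S=\begin{pmatrix}1&\lambda_p\\0&1\end{pmatrix}$, $T=\begin{pmatrix}0&-1\\1&0\end{pmatrix}$ and $U=ST=\begin{pmatrix}\lambda_p&-1\\1&0\end{pmatrix}$, and let $G_p=\langle S,T\rangle/\{\pm I\}\subset \mathrm{PSL}(2,\mathbb R)$ be the Hecke group. For a positive integer $k$, a rational period function (RPF) of weight $2k$ for $G_p$ is a rational function $q\in\mathbb C(z)$ such that $$q+q\mid T=0,\qquad q+q\mid U+\cdots+q\mid U^{p-1}=0,$$ where $(q\mid M)(z)=(cz+d)^{-2k}\,q(Mz)$ for $M=\begin{pmatrix}a&b\\c&d\end{pmatrix}$. An irreducible system of poles (ISP) for $G_p$ is a minimal set of nonzero poles forced to occur together by these relations: a set $P\subset\mathbb C$ for which there is a nonzero pole $\alpha$ of some RPF for $G_p$ such that $P$ is the set of all $\beta\ne 0$ that are poles of every RPF for $G_p$ (of any weight $2k$, $k\geq 1$) having a pole at $\alpha$. For $n\ge 1$ let $B_p(n)$ be the number of ISPs for $G_p$ that contain exactly $n$ positive real numbers. Let $C_m(n)$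 be the number of primitive necklaces of length $n$ on $m$ letters, that is, of words of length $n$ on $m$ letters that are not fixed by cyclic rotation by any divisor $d<n$ of $n$, counted up to cyclic rotation. Then $B_p(n)$ is finite for every $n\ge1$, $B_p(1)=p-3$, and for every $n>1$ $$B_p(n)=C_{p-1}(n)=\frac1n\sum_{d\mid n}\mu(d)\,(p-1)^{n/d},$$ where $\mu$ is the Möbius function. -/

import Mathlib

namespace HeckeRPF

noncomputable section

/-- `λ_p = 2 cos (π / p)`. -/
def heckeLambda (p : ℕ) : ℝ := 2 * Real.cos (Real.pi / p)

/-- The translation `S = (1 λ_p; 0 1)`. -/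
def heckeS (p : ℕ) : Matrix.SpecialLinearGroup (Fin 2) ℝ :=
  ⟨!![1, heckeLambda p; 0, 1], by simp [Matrix.det_fin_two]⟩

/-- The inversion `T = (0 -1; 1 0)`. -/
def heckeT : Matrix.SpecialLinearGroup (Fin 2) ℝ :=
  ⟨!![0, -1; 1, 0], by simp [Matrix.det_fin_two]⟩

/-- The element `U = S T = (λ_p -1; 1 0)`. The Hecke group `G_p` is the image in `PSL(2, ℝ)` of
the group generated by `S` and `T`, equivalently by `T` and `U`. -/
def heckeU (p : ℕ) : Matrix.SpecialLinearGroup (Fin 2) ℝ := heckeS p * heckeT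

/-- The weight `2k` slash operator `(f ∣ M)(z) = (c z + d) ^ (-2k) * f (M z)` for
`M = (a b; c d)`. -/
def slash (k : ℕ) (f : ℂ → ℂ) (M : Matrix.SpecialLinearGroup (Fin 2) ℝ) (z : ℂ) : ℂ :=
  (((M 1 0 : ℝ) : ℂ) * z + ((M 1 1 : ℝ) : ℂ)) ^ (-(2 * (k : ℤ))) *
    f ((((M 0 0 : ℝ) : ℂ) * z + ((M 0 1 : ℝ) : ℂ)) /
      (((M 1 0 : ℝ) : ℂ) * z + ((M 1 1 : ℝ) : ℂ)))

/-- The function on `ℂ` given by a rational function in lowest terms (its value at the finitely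
many poles is irrelevant). -/
def toFun (q : RatFunc ℂ) (z : ℂ) : ℂ := q.eval (RingHom.id ℂ) z

/-- `q` is a rational period function of weight `2k` for `G_p`:
`q + q ∣ T = 0` and `q + q ∣ U + ⋯ + q ∣ U ^ (p - 1) = 0`.
Identities between rational functions are identities at all but finitely many points of `ℂ`. -/
structure IsRPF (p k : ℕ) (q : RatFunc ℂ) : Prop where
  first_relation : ∀ᶠ z : ℂ in Filter.cofinite, toFun q z + slash k (toFun q) heckeT z = 0
  second_relation : ∀ᶠ z : ℂ in Filter.cofinite,
    ∑ j ∈ Finset.range p, slash k (toFun q) (heckeU p ^ j) z = 0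

/-- The nonzero (finite) poles of a rational function. -/
def nonzeroPoles (q : RatFunc ℂ) : Set ℂ := {α : ℂ | α ≠ 0 ∧ q.denom.IsRoot α}

/-- `P` is an irreducible system of poles for `G_p`: for some nonzero pole `α` of a rational period
function, `P` is the smallest set of nonzero poles which the two relations force to occur together
with `α`, i.e. the set of all nonzero poles common to all rational period functions for `G_p`, of
any positive even weight `2k`, that have a pole at `α`. -/
def IsISP (p : ℕ) (P : Set ℂ) : Prop :=
  ∃ α : ℂ, (∃ (k : ℕ) (q : RatFunc ℂ), 0 < k ∧ IsRPF p k q ∧ α ∈ nonzeroPoles q) ∧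
    P = {β : ℂ | ∀ (k : ℕ) (q : RatFunc ℂ), 0 < k → IsRPF p k q →
      α ∈ nonzeroPoles q → β ∈ nonzeroPoles q}

/-- The positive real elements of a set of complex numbers. -/
def positivePart (P : Set ℂ) : Set ℝ := {x : ℝ | 0 < x ∧ (x : ℂ) ∈ P}

/-- The set of irreducible systems of poles for `G_p` with exactly `n` positive poles. -/
def ISPsWith (p n : ℕ) : Set (Set ℂ) := {P | IsISP p P ∧ (positivePart P).encard = n}

/-- A word is primitive if it has no nontrivial sub-period: for no proper divisor `d` of its length
is it invariant under cyclic rotation by `d`. -/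
def IsPrimitiveWord {A : Type} (w : List A) : Prop :=
  ∀ d : ℕ, d ∣ w.length → d < w.length → w.rotate d ≠ w

/-- The set of primitive necklaces (words up to cyclic rotation) of length `n` on `q` letters. -/
def primitiveNecklaces (q n : ℕ) : Set (Cycle (Fin q)) :=
  {c | ∃ w : List (Fin q), w.length = n ∧ IsPrimitiveWord w ∧ (w : Cycle (Fin q)) = c}

/-- `C_q(n)`, the number of primitive necklaces of length `n` on `q` letters. -/
def numPrimitiveNecklaces (q n : ℕ) : ℕ := (primitiveNecklaces q n).ncard

end

end HeckeRPF

/-!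
The transformations `V_j = U ^ j T`, for `1 ≤ j ≤ p - 1`, map the right half-plane into itself with
pairwise disjoint images, because each `U ^ j` maps the left half-plane into the right one
(`mob_heckeU_pow_re_pos`) and `T` exchanges the two.

*Poles are forced along periodic orbits.* If a rational period function has a pole `b` in the right
half-plane, the first relation gives the pole `-1 / b`, and the second one gives a pole
`V_j b` for some `j`. By ping-pong the map `b ↦ V_j b` is injective on the finite set of right
poles, hence a permutation (`IsRPF.exists_perm`), and no nonzero pole is purely imaginary. So each right
pole is a fixed point of a word in the `V_j`. Up to sign these words are matrices with nonnegative
entries; such a matrix, if not the identity, has at most one fixed point in the right half-plane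
(`IsNonneg.fixed_unique`), and it has one, which is real, as soon as all its entries are positive.
Thus the positive poles correspond to the periodic sequences of digits in `Fin (p - 1)`
other than the two constant sequences whose words are parabolic (`codes`), and a pole forces the
poles coded by all shifts of its sequence (`IsRPF.exists_code`).

*Nothing else is forced.* In weight two the slash operator is the pullback of the differential
`q dz`. A logarithmic differential is determined by its divisor of residues, so it suffices to
find a divisor `D` of degree zero with `T D = -D` and `∑ j, U ^ j D = 0`. For a shift orbit of codes
with points `x i`, take `D = ∑ i, ([x i] - [T x i])`: since `x i` lies in the `U`-orbit of
`T x (i + 1)`, the second sum telescopes (`isRPF_logDerivRat`). The resulting function has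
exactly the forced poles.

Hence the irreducible systems of poles with `n` positive elements are the shift orbits of codes of
minimal period `n`. For `n > 1` these are the primitive necklaces, and for `n = 1` the `p - 1`
constant sequences without the two parabolic ones. The necklaces are counted by Möbius inversion of
`∑ d ∣ n, d C(d) = (p - 1) ^ n`.
-/

namespace HeckeRPF

open Filter Topology Function

/-! ### Möbius transformations of the complex plane -/

/-- The denominator `c z + d` of the Möbius transformation attached to `M = (a b; c d)`. -/
noncomputable def den (M : Matrix.SpecialLinearGroup (Fin 2) ℝ) (z : ℂ) : ℂ :=
  ((M 1 0 : ℝ) : ℂ) * z + ((M 1 1 : ℝ) : ℂ)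

/-- The Möbius transformation `z ↦ (a z + b) / (c z + d)` attached to `M = (a b; c d)`. It takes
the junk value `0` where `c z + d = 0`, so most facts about it assume `den M z ≠ 0`. -/
noncomputable def mob (M : Matrix.SpecialLinearGroup (Fin 2) ℝ) (z : ℂ) : ℂ :=
  (((M 0 0 : ℝ) : ℂ) * z + ((M 0 1 : ℝ) : ℂ)) / den M z

lemma slash_eq (k : ℕ) (f : ℂ → ℂ) (M : Matrix.SpecialLinearGroup (Fin 2) ℝ) (z : ℂ) :
    slash k f M z = den M z ^ (-(2 * (k : ℤ))) * f (mob M z) := rfl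

lemma det_eq (M : Matrix.SpecialLinearGroup (Fin 2) ℝ) :
    M 0 0 * M 1 1 - M 0 1 * M 1 0 = 1 := by
  have := M.2
  rwa [Matrix.det_fin_two] at this

lemma det_eq_complex (M : Matrix.SpecialLinearGroup (Fin 2) ℝ) :
    ((M 0 0 : ℝ) : ℂ) * ((M 1 1 : ℝ) : ℂ) - ((M 0 1 : ℝ) : ℂ) * ((M 1 0 : ℝ) : ℂ) = 1 := by
  exact_mod_cast det_eq M

lemma den_mul (M N : Matrix.SpecialLinearGroup (Fin 2) ℝ) {z : ℂ} (h : den N z ≠ 0) :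
    den (M * N) z = den M (mob N z) * den N z := by
  have e : den M (mob N z) * den N z = ((M 1 0 : ℝ) : ℂ) *
      (((N 0 0 : ℝ) : ℂ) * z + ((N 0 1 : ℝ) : ℂ)) + ((M 1 1 : ℝ) : ℂ) * den N z := by
    rw [den, mob, add_mul, mul_assoc, div_mul_cancel₀ _ h]
  rw [e]
  simp only [den, Matrix.SpecialLinearGroup.coe_mul, Matrix.mul_apply, Fin.sum_univ_two]
  push_cast
  ring

lemma mob_mul (M N : Matrix.SpecialLinearGroup (Fin 2) ℝ) {z : ℂ} (h : den N z ≠ 0) :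
    mob (M * N) z = mob M (mob N z) := by
  have e : (((M 0 0 : ℝ) : ℂ) * mob N z + ((M 0 1 : ℝ) : ℂ)) * den N z =
      (((M * N) 0 0 : ℝ) : ℂ) * z + (((M * N) 0 1 : ℝ) : ℂ) := by
    have e' : (((M 0 0 : ℝ) : ℂ) * mob N z + ((M 0 1 : ℝ) : ℂ)) * den N z = ((M 0 0 : ℝ) : ℂ) *
        (((N 0 0 : ℝ) : ℂ) * z + ((N 0 1 : ℝ) : ℂ)) + ((M 0 1 : ℝ) : ℂ) * den N z := by
      rw [mob, add_mul, mul_assoc, div_mul_cancel₀ _ h]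
    rw [e']
    simp only [den, Matrix.SpecialLinearGroup.coe_mul, Matrix.mul_apply, Fin.sum_univ_two]
    push_cast
    ring
  rw [mob, den_mul M N h, ← e, mul_div_mul_right _ _ h]
  rfl

lemma den_neg (M : Matrix.SpecialLinearGroup (Fin 2) ℝ) (z : ℂ) : den (-M) z = -den M z := by
  simp [den]
  ring

lemma mob_neg (M : Matrix.SpecialLinearGroup (Fin 2) ℝ) (z : ℂ) : mob (-M) z = mob M z := by
  rw [mob, mob, den_neg, ← neg_div_neg_eq]
  simp
  ring

@[simp] lemma den_one (z : ℂ) : den 1 z = 1 := by simp [den]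

@[simp] lemma mob_one (z : ℂ) : mob 1 z = z := by simp [mob]

lemma mob_sub_mob (M : Matrix.SpecialLinearGroup (Fin 2) ℝ) {z w : ℂ} (hz : den M z ≠ 0)
    (hw : den M w ≠ 0) : mob M z - mob M w = (z - w) / (den M z * den M w) := by
  rw [mob, mob, div_sub_div _ _ hz hw]
  congr 1
  simp only [den]
  linear_combination (z - w) * det_eq_complex M

lemma mob_inj (M : Matrix.SpecialLinearGroup (Fin 2) ℝ) {z w : ℂ} (hz : den M z ≠ 0)
    (hw : den M w ≠ 0) (h : mob M z = mob M w) : z = w := by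
  have := mob_sub_mob M hz hw
  rw [h, sub_self, eq_comm, div_eq_zero_iff] at this
  rcases this with h | h
  · exact sub_eq_zero.mp h
  · exact absurd h (mul_ne_zero hz hw)

lemma finite_den_eq_zero (M : Matrix.SpecialLinearGroup (Fin 2) ℝ) : {z | den M z = 0}.Finite := by
  refine Set.Subsingleton.finite fun z hz w hw => ?_
  simp only [Set.mem_ofPred_eq, den] at hz hw
  have hd := det_eq_complex M
  linear_combination (w - z) * hd - (((M 0 0 : ℝ) : ℂ) * w + ((M 0 1 : ℝ) : ℂ)) * hz +
    (((M 0 0 : ℝ) : ℂ) * z + ((M 0 1 : ℝ) : ℂ)) * hw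

lemma eventually_den_ne_zero (M : Matrix.SpecialLinearGroup (Fin 2) ℝ) :
    ∀ᶠ z in cofinite, den M z ≠ 0 := by
  rw [eventually_cofinite]
  simpa using finite_den_eq_zero M

lemma tendsto_mob_cofinite (M : Matrix.SpecialLinearGroup (Fin 2) ℝ) :
    Tendsto (mob M) cofinite cofinite := by
  rw [tendsto_def]
  intro s hs
  rw [mem_cofinite] at hs ⊢
  have h2 : ({z | den M z ≠ 0} ∩ mob M ⁻¹' sᶜ).Finite := by
    refine Set.Finite.of_finite_image (f := mob M) (hs.subset ?_) ?_
    · rintro _ ⟨z, hz, rfl⟩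
      exact hz.2
    · intro z hz w hw h
      exact mob_inj M hz.1 hw.1 h
  refine ((finite_den_eq_zero M).union h2).subset fun z hz => ?_
  by_cases h : den M z = 0
  · exact Or.inl h
  · exact Or.inr ⟨h, hz⟩

lemma continuous_den (M : Matrix.SpecialLinearGroup (Fin 2) ℝ) : Continuous (den M) := by
  unfold den
  fun_prop

lemma continuousAt_mob (M : Matrix.SpecialLinearGroup (Fin 2) ℝ) {z : ℂ} (h : den M z ≠ 0) :
    ContinuousAt (mob M) z := by
  unfold mob
  exact ContinuousAt.div (by fun_prop) (continuous_den M).continuousAt h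

@[simp] lemma den_heckeT (z : ℂ) : den heckeT z = z := by simp [den, heckeT]

@[simp] lemma mob_heckeT (z : ℂ) : mob heckeT z = -1 / z := by simp [mob, heckeT, den]

lemma neg_one_div_re_neg {z : ℂ} (hz : 0 < z.re) : (-1 / z).re < 0 := by
  have h : z ≠ 0 := fun h => by simp [h] at hz
  have := Complex.normSq_pos.mpr h
  simp only [Complex.div_re, Complex.neg_re, Complex.one_re, Complex.neg_im, Complex.one_im]
  have : 0 < z.re / Complex.normSq z := by positivity
  simp only [neg_mul, one_mul, neg_zero, zero_mul, zero_div, add_zero, neg_div]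
  linarith

lemma neg_one_div_re_pos {z : ℂ} (hz : z.re < 0) : 0 < (-1 / z).re := by
  have := neg_one_div_re_neg (z := -z) (by simpa using hz)
  rw [neg_div_neg_eq, one_div] at this
  rw [neg_div, one_div, Complex.neg_re]
  linarith

lemma neg_one_div_neg_one_div (z : ℂ) : -1 / (-1 / z) = z := by simp [neg_div]

lemma mob_re (M : Matrix.SpecialLinearGroup (Fin 2) ℝ) (z : ℂ) :
    (mob M z).re = (M 0 0 * M 1 0 * Complex.normSq z + (M 0 0 * M 1 1 + M 0 1 * M 1 0) * z.re +
      M 0 1 * M 1 1) / Complex.normSq (den M z) := by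
  rw [mob, Complex.div_re, ← add_div]
  congr 1
  simp [den, Complex.normSq_apply]
  ring

/-! ### Powers of `U` -/

/-- The normalised sine `s_j = sin (j π / p) / sin (π / p)`; these are the entries of `U ^ j`. -/
noncomputable def sn (p j : ℕ) : ℝ := Real.sin (j * (Real.pi / p)) / Real.sin (Real.pi / p)

lemma angle_pos {p : ℕ} (hp : 3 ≤ p) : 0 < Real.pi / p := by
  have : (0 : ℝ) < p := by exact_mod_cast (by omega : 0 < p)
  exact div_pos Real.pi_pos this

lemma sin_pos_of_index {p j : ℕ} (hp : 3 ≤ p) (h0 : 0 < j) (hj : j < p) :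
    0 < Real.sin (j * (Real.pi / p)) := by
  have h : (0 : ℝ) < p := by exact_mod_cast (by omega : 0 < p)
  apply Real.sin_pos_of_pos_of_lt_pi
  · exact mul_pos (by exact_mod_cast h0) (angle_pos hp)
  · have : (j : ℝ) < p := by exact_mod_cast hj
    rw [mul_div_assoc', div_lt_iff₀ h, mul_comm]
    exact mul_lt_mul_of_pos_left this Real.pi_pos

lemma sin_angle_pos {p : ℕ} (hp : 3 ≤ p) : 0 < Real.sin (Real.pi / p) := by
  simpa using sin_pos_of_index hp one_pos (by omega)

@[simp] lemma sn_zero (p : ℕ) : sn p 0 = 0 := by simp [sn]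

lemma sn_one {p : ℕ} (hp : 3 ≤ p) : sn p 1 = 1 := by
  simp [sn, (sin_angle_pos hp).ne']

lemma sn_self {p : ℕ} (hp : 3 ≤ p) : sn p p = 0 := by
  have h : (p : ℝ) ≠ 0 := by exact_mod_cast (by omega : p ≠ 0)
  rw [sn, mul_div_cancel₀ _ h]
  simp

lemma sn_pos {p j : ℕ} (hp : 3 ≤ p) (h0 : 0 < j) (hj : j < p) : 0 < sn p j :=
  div_pos (sin_pos_of_index hp h0 hj) (sin_angle_pos hp)

lemma sn_nonneg {p j : ℕ} (hp : 3 ≤ p) (hj : j ≤ p) : 0 ≤ sn p j := by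
  rcases hj.eq_or_lt with rfl | hj
  · rw [sn_self hp]
  · rcases Nat.eq_zero_or_pos j with rfl | h0
    · simp
    · exact (sn_pos hp h0 hj).le

lemma sn_add_two (p j : ℕ) : sn p (j + 2) = heckeLambda p * sn p (j + 1) - sn p j := by
  simp only [sn, heckeLambda]
  set t := Real.pi / p
  rw [← mul_div_assoc (2 * Real.cos t), ← sub_div]
  congr 1
  push_cast
  rw [show ((j : ℝ) + 2) * t = (j + 1) * t + t by ring, Real.sin_add,
    show (j : ℝ) * t = (j + 1) * t - t by ring, Real.sin_sub]
  ring

lemma coe_heckeU (p : ℕ) :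
    (heckeU p : Matrix (Fin 2) (Fin 2) ℝ) = !![heckeLambda p, -1; 1, 0] := by
  rw [heckeU, Matrix.SpecialLinearGroup.coe_mul]
  simp [heckeS, heckeT]

lemma heckeU_pow_entries {p : ℕ} (hp : 3 ≤ p) (j : ℕ) :
    (heckeU p ^ (j + 1)) 0 0 = sn p (j + 2) ∧ (heckeU p ^ (j + 1)) 0 1 = -sn p (j + 1) ∧
    (heckeU p ^ (j + 1)) 1 0 = sn p (j + 1) ∧ (heckeU p ^ (j + 1)) 1 1 = -sn p j := by
  have hU : ∀ M : Matrix.SpecialLinearGroup (Fin 2) ℝ,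
      (heckeU p * M) 0 0 = heckeLambda p * M 0 0 - M 1 0 ∧
      (heckeU p * M) 0 1 = heckeLambda p * M 0 1 - M 1 1 ∧
      (heckeU p * M) 1 0 = M 0 0 ∧ (heckeU p * M) 1 1 = M 0 1 := by
    intro M
    simp only [Matrix.SpecialLinearGroup.coe_mul, coe_heckeU]
    simp [Matrix.mul_apply, Fin.sum_univ_two, sub_eq_add_neg]
  induction j with
  | zero =>
    have h := hU 1
    rw [mul_one] at h
    simp [h, sn_add_two, sn_one hp]
  | succ j ih =>
    rw [pow_succ']
    obtain ⟨h1, h2, h3, h4⟩ := hU (heckeU p ^ (j + 1))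
    obtain ⟨i1, i2, i3, i4⟩ := ih
    rw [h1, h2, h3, h4, i1, i2, i3, i4, sn_add_two p (j + 1), sn_add_two p j]
    refine ⟨?_, ?_, ?_, ?_⟩ <;> ring

lemma heckeU_pow_self {p : ℕ} (hp : 3 ≤ p) : heckeU p ^ p = -1 := by
  obtain ⟨j, rfl⟩ : ∃ j, p = j + 1 := ⟨p - 1, by omega⟩
  obtain ⟨h1, h2, h3, h4⟩ := heckeU_pow_entries hp j
  have hs := sn_self hp
  have h := sn_add_two (j + 1) j
  have hd := det_eq (heckeU (j + 1) ^ (j + 1))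
  have hj : 0 < sn (j + 1) j := sn_pos hp (by omega) (by omega)
  rw [hs, mul_zero, zero_sub] at h
  rw [h1, h2, h3, h4, hs, h] at hd
  have : sn (j + 1) j = 1 := by nlinarith
  ext a b
  fin_cases a <;> fin_cases b <;> simp [h1, h2, h3, h4, hs, h, this]

lemma heckeU_pow_add {p : ℕ} (hp : 3 ≤ p) (m : ℕ) : heckeU p ^ (m + p) = -heckeU p ^ m := by
  rw [pow_add, heckeU_pow_self hp, mul_neg, mul_one]

lemma mob_heckeU_pow_add {p : ℕ} (hp : 3 ≤ p) (m : ℕ) (z : ℂ) :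
    mob (heckeU p ^ (m + p)) z = mob (heckeU p ^ m) z := by
  rw [heckeU_pow_add hp, mob_neg]

lemma den_heckeU_pow_ne_zero {p : ℕ} (hp : 3 ≤ p) {z : ℂ} (hz : z.re ≤ 0) (h0 : z ≠ 0) (m : ℕ) :
    den (heckeU p ^ m) z ≠ 0 := by
  induction m using Nat.strong_induction_on with
  | _ m ih =>
    rcases lt_or_ge m p with hm | hm
    · rcases m with _ | j
      · simp
      · obtain ⟨h1, h2, h3, h4⟩ := heckeU_pow_entries hp j
        have hj := sn_pos hp (Nat.succ_pos j) hm
        have hj' := sn_nonneg hp (j := j) (by omega)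
        intro h
        rw [den, h3, h4] at h
        have hr := congrArg Complex.re h
        have hi := congrArg Complex.im h
        simp at hr hi
        apply h0
        apply Complex.ext
        · have : sn p (j + 1) * z.re = 0 := by nlinarith
          rcases mul_eq_zero.mp this with h | h
          · exact absurd h hj.ne'
          · exact h
        · rcases hi with h | h
          · exact absurd h hj.ne'
          · exact h
    · obtain ⟨n, rfl⟩ : ∃ n, m = n + p := ⟨m - p, by omega⟩
      rw [heckeU_pow_add hp, den_neg]
      exact neg_ne_zero.mpr (ih n (by omega))

lemma mob_heckeU_pow_comp {p : ℕ} (hp : 3 ≤ p) {z : ℂ} (hz : z.re ≤ 0) (h0 : z ≠ 0) (m n : ℕ) :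
    mob (heckeU p ^ m) (mob (heckeU p ^ n) z) = mob (heckeU p ^ (m + n)) z := by
  rw [pow_add, mob_mul _ _ (den_heckeU_pow_ne_zero hp hz h0 n)]

lemma den_heckeU_pow_mob_ne_zero {p : ℕ} (hp : 3 ≤ p) {z : ℂ} (hz : z.re ≤ 0) (h0 : z ≠ 0)
    (m n : ℕ) : den (heckeU p ^ m) (mob (heckeU p ^ n) z) ≠ 0 := by
  have h := den_mul (heckeU p ^ m) (heckeU p ^ n) (den_heckeU_pow_ne_zero hp hz h0 n)
  rw [← pow_add] at h
  exact left_ne_zero_of_mul (h ▸ den_heckeU_pow_ne_zero hp hz h0 (m + n))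

/-- The half-planes `Re z < 0` and `Re z > 0` play ping-pong under the powers of `U`. The closed
boundary `Re z = 0` is included, without the origin. -/
lemma mob_heckeU_pow_re_pos {p : ℕ} (hp : 3 ≤ p) {z : ℂ} (hz : z.re ≤ 0) (h0 : z ≠ 0) {j : ℕ}
    (hj0 : 0 < j) (hj : j < p) : 0 < (mob (heckeU p ^ j) z).re := by
  have hd := den_heckeU_pow_ne_zero hp hz h0 j
  obtain ⟨i, rfl⟩ : ∃ i, j = i + 1 := ⟨j - 1, by omega⟩
  obtain ⟨h1, h2, h3, h4⟩ := heckeU_pow_entries hp i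
  rw [mob_re, h1, h2, h3, h4]
  refine div_pos ?_ (Complex.normSq_pos.mpr hd)
  have hn := Complex.normSq_pos.mpr h0
  have p1 := sn_pos hp hj0 hj
  have p0 := sn_nonneg hp (j := i) (by omega)
  have p2 := sn_nonneg hp (j := i + 2) (by omega)
  have t1 : 0 ≤ sn p (i + 2) * sn p (i + 1) * Complex.normSq z := by positivity
  have t2 : 0 ≤ sn p (i + 1) * sn p i := by positivity
  have t3 : 0 ≤ (sn p (i + 2) * sn p i + sn p (i + 1) * sn p (i + 1)) * (-z.re) :=
    mul_nonneg (by positivity) (by linarith)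
  rcases Nat.eq_zero_or_pos i with rfl | hi
  · have : 0 < sn p (0 + 2) * sn p (0 + 1) * Complex.normSq z := by
      have := sn_pos hp (j := 0 + 2) (by omega) (by omega)
      positivity
    nlinarith
  · have : 0 < sn p (i + 1) * sn p i := by
      have := sn_pos hp hi (by omega)
      positivity
    nlinarith

/-- Each orbit under `U` contains at most one point of the half-plane `Re z ≤ 0`, apart from the
origin. -/
lemma eq_of_mob_heckeU_pow_eq {p : ℕ} (hp : 3 ≤ p) {z w : ℂ} (hz : z.re ≤ 0) (hz0 : z ≠ 0)
    (hw : w.re ≤ 0) (hw0 : w ≠ 0) {i j : ℕ} (hi : i < p) (hj : j < p)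
    (h : mob (heckeU p ^ i) z = mob (heckeU p ^ j) w) : i = j ∧ z = w := by
  wlog hij : i ≤ j generalizing i j z w
  · obtain ⟨h1, h2⟩ := this hw hw0 hz hz0 hj hi h.symm (by omega)
    exact ⟨h1.symm, h2.symm⟩
  -- apply `U ^ (p - i)` to both sides
  have h' := congrArg (mob (heckeU p ^ (p - i))) h
  rw [mob_heckeU_pow_comp hp hz hz0, mob_heckeU_pow_comp hp hw hw0,
    show p - i + i = 0 + p by omega, show p - i + j = (j - i) + p by omega,
    mob_heckeU_pow_add hp, mob_heckeU_pow_add hp, pow_zero, mob_one] at h'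
  rcases hij.eq_or_lt with rfl | hlt
  · rw [Nat.sub_self, pow_zero, mob_one] at h'
    exact ⟨rfl, h'⟩
  · have := mob_heckeU_pow_re_pos hp hw hw0 (j := j - i) (by omega) (by omega)
    rw [← h'] at this
    linarith

/-! ### Poles of rational functions -/

lemma toFun_eq (q : RatFunc ℂ) (z : ℂ) : toFun q z = q.num.eval z / q.denom.eval z := rfl

lemma continuousAt_toFun {q : RatFunc ℂ} {a : ℂ} (h : ¬q.denom.IsRoot a) :
    ContinuousAt (toFun q) a := by
  have e : toFun q = fun z => q.num.eval z / q.denom.eval z := rfl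
  rw [e]
  exact ContinuousAt.div q.num.continuous.continuousAt q.denom.continuous.continuousAt h

lemma tendsto_toFun_of_isRoot {q : RatFunc ℂ} {a : ℂ} (h : q.denom.IsRoot a) :
    Tendsto (toFun q) (𝓝[≠] a) (Bornology.cobounded ℂ) := by
  have hn : q.num.eval a ≠ 0 := by
    intro hn
    obtain ⟨u, v, huv⟩ := q.isCoprime_num_denom
    have := congrArg (Polynomial.eval a) huv
    simp [hn, h.eq_zero] at this
  have hd : Tendsto (fun z => q.denom.eval z) (𝓝[≠] a) (𝓝[≠] 0) := by
    refine tendsto_nhdsWithin_iff.mpr ⟨?_, ?_⟩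
    · have := q.denom.continuous.tendsto a
      rw [h.eq_zero] at this
      exact this.mono_left nhdsWithin_le_nhds
    · have hf : {z | q.denom.eval z = 0}.Finite := by
        refine (q.denom.roots.toFinset.finite_toSet).subset fun z hz => ?_
        simpa [q.denom_ne_zero] using hz
      have : ∀ᶠ z in cofinite, q.denom.eval z ≠ 0 := by
        rw [eventually_cofinite]
        simpa using hf
      exact this.filter_mono (nhdsNE_le_cofinite a)
  have e : toFun q = fun z => q.num.eval z * (q.denom.eval z)⁻¹ := by
    funext z
    rw [toFun_eq, div_eq_mul_inv]
  rw [e, ← tendsto_norm_atTop_iff_cobounded]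
  simp only [norm_mul]
  refine Tendsto.pos_mul_atTop (norm_pos_iff.mpr hn)
    ((q.num.continuous.tendsto a).norm.mono_left nhdsWithin_le_nhds) ?_
  rw [tendsto_norm_atTop_iff_cobounded]
  exact tendsto_inv₀_nhdsNE_zero.comp hd

/-- A function tending to infinity at `a` does not cancel, off a finite set, against a function
which is continuous at `a`. -/
lemma not_tendsto_cobounded_of_add_eq_zero {f g : ℂ → ℂ} {a : ℂ} (hg : ContinuousAt g a)
    (h : ∀ᶠ z in cofinite, f z + g z = 0) :
    ¬Tendsto f (𝓝[≠] a) (Bornology.cobounded ℂ) := by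
  intro hf
  have h' : ∀ᶠ z in 𝓝[≠] a, f z = -g z := by
    filter_upwards [h.filter_mono (nhdsNE_le_cofinite a)] with z hz
    exact eq_neg_of_add_eq_zero_left hz
  have h1 := (hg.neg.tendsto.mono_left nhdsWithin_le_nhds).congr' (h'.mono fun z hz => hz.symm)
  exact h1.not_tendsto (Metric.disjoint_nhds_cobounded _) hf

lemma continuousAt_slash {q : RatFunc ℂ} (k : ℕ) {M : Matrix.SpecialLinearGroup (Fin 2) ℝ} {a : ℂ}
    (hd : den M a ≠ 0) (h : ¬q.denom.IsRoot (mob M a)) :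
    ContinuousAt (slash k (toFun q) M) a := by
  have e : slash k (toFun q) M = fun z => den M z ^ (-(2 * (k : ℤ))) * toFun q (mob M z) := rfl
  rw [e]
  refine ContinuousAt.mul ((continuous_den M).continuousAt.zpow₀ _ (Or.inl hd)) ?_
  exact (continuousAt_toFun h).comp (continuousAt_mob M hd)

/-! ### What the two relations force on the poles -/

section

variable {p k : ℕ} {q : RatFunc ℂ}

lemma IsRPF.isRoot_neg_one_div (hq : IsRPF p k q) {a : ℂ} (ha : a ≠ 0) (h : q.denom.IsRoot a) :
    q.denom.IsRoot (-1 / a) := by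
  by_contra hn
  refine not_tendsto_cobounded_of_add_eq_zero (f := toFun q) (a := a)
    (continuousAt_slash (q := q) k (M := heckeT) ?_ ?_) hq.first_relation
    (tendsto_toFun_of_isRoot h)
  · simpa using ha
  · simpa using hn

lemma IsRPF.exists_isRoot (hp : 3 ≤ p) (hq : IsRPF p k q) {a : ℂ} (ha : a.re ≤ 0) (h0 : a ≠ 0)
    (h : q.denom.IsRoot a) :
    ∃ j, 0 < j ∧ j < p ∧ q.denom.IsRoot (mob (heckeU p ^ j) a) := by
  by_contra! hn
  refine not_tendsto_cobounded_of_add_eq_zero (f := toFun q) (a := a)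
    (g := fun z => ∑ j ∈ Finset.range (p - 1), slash k (toFun q) (heckeU p ^ (j + 1)) z) ?_ ?_
    (tendsto_toFun_of_isRoot h)
  · refine tendsto_finsetSum _ fun j hj => ?_
    have hj := Finset.mem_range.mp hj
    exact continuousAt_slash k (den_heckeU_pow_ne_zero hp ha h0 _)
      (hn (j + 1) (by omega) (by omega))
  · filter_upwards [hq.second_relation] with z hz
    rw [show p = (p - 1) + 1 by omega, Finset.sum_range_succ'] at hz
    rw [add_comm, ← hz]
    rw [show p - 1 + 1 = p by omega]
    simp [slash_eq]

lemma finite_isRoot (q : RatFunc ℂ) : {a | q.denom.IsRoot a}.Finite := by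
  refine (q.denom.roots.toFinset.finite_toSet).subset fun z hz => ?_
  simpa [q.denom_ne_zero] using hz

/-- The poles of `q` in the right half-plane. -/
def rightPoles (q : RatFunc ℂ) : Set ℂ := {a | 0 < a.re ∧ q.denom.IsRoot a}

lemma finite_rightPoles (q : RatFunc ℂ) : (rightPoles q).Finite :=
  (finite_isRoot q).subset fun _ h => h.2

lemma ne_zero_of_re_pos {z : ℂ} (h : 0 < z.re) : z ≠ 0 := fun h0 => by simp [h0] at h

lemma neg_one_div_ne_zero {z : ℂ} (h : z ≠ 0) : -1 / z ≠ 0 := by simp [h]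

/-- Each right pole `b` yields a left pole `-1 / b`, hence a right pole `U ^ j (-1 / b)`. By
ping-pong this assignment is injective; the set of right poles being finite, it is a
permutation. -/
lemma IsRPF.exists_perm (hp : 3 ≤ p) (hq : IsRPF p k q) :
    ∃ (e : Equiv.Perm (rightPoles q)) (d : rightPoles q → ℕ), ∀ b : rightPoles q,
      0 < d b ∧ d b < p ∧ (e b : ℂ) = mob (heckeU p ^ d b) (-1 / (b : ℂ)) := by
  have H : ∀ b : rightPoles q, ∃ j, 0 < j ∧ j < p ∧
      q.denom.IsRoot (mob (heckeU p ^ j) (-1 / (b : ℂ))) := by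
    intro b
    have hb := ne_zero_of_re_pos b.2.1
    exact hq.exists_isRoot hp (neg_one_div_re_neg b.2.1).le (neg_one_div_ne_zero hb)
      (hq.isRoot_neg_one_div hb b.2.2)
  choose d hd0 hdp hd using H
  have : Finite (rightPoles q) := (finite_rightPoles q).to_subtype
  let f : rightPoles q → rightPoles q := fun b =>
    ⟨mob (heckeU p ^ d b) (-1 / (b : ℂ)), mob_heckeU_pow_re_pos hp (neg_one_div_re_neg b.2.1).le
      (neg_one_div_ne_zero (ne_zero_of_re_pos b.2.1)) (hd0 b) (hdp b), hd b⟩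
  have hf : Function.Injective f := by
    intro b c hbc
    have h1 := congrArg Subtype.val hbc
    have h2 := (eq_of_mob_heckeU_pow_eq hp (neg_one_div_re_neg b.2.1).le
      (neg_one_div_ne_zero (ne_zero_of_re_pos b.2.1)) (neg_one_div_re_neg c.2.1).le
      (neg_one_div_ne_zero (ne_zero_of_re_pos c.2.1)) (hdp b) (hdp c) h1).2
    have h3 := congrArg (fun z : ℂ => -1 / z) h2
    simp only [neg_one_div_neg_one_div] at h3
    exact Subtype.ext h3
  exact ⟨Equiv.ofBijective f (Finite.injective_iff_bijective.mp hf), d,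
    fun b => ⟨hd0 b, hdp b, rfl⟩⟩

/-- There are no nonzero poles on the imaginary axis. -/
lemma IsRPF.re_ne_zero (hp : 3 ≤ p) (hq : IsRPF p k q) {a : ℂ} (h0 : a ≠ 0)
    (h : q.denom.IsRoot a) : a.re ≠ 0 := by
  intro ha
  obtain ⟨j, hj0, hjp, hj⟩ := hq.exists_isRoot hp ha.le h0 h
  obtain ⟨e, d, hd⟩ := hq.exists_perm hp
  let c : rightPoles q := ⟨_, mob_heckeU_pow_re_pos hp ha.le h0 hj0 hjp, hj⟩
  obtain ⟨b, hb⟩ := e.surjective c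
  obtain ⟨-, hbp, hbe⟩ := hd b
  rw [hb] at hbe
  have := (eq_of_mob_heckeU_pow_eq hp ha.le h0 (neg_one_div_re_neg b.2.1).le
    (neg_one_div_ne_zero (ne_zero_of_re_pos b.2.1)) hjp hbp hbe).2
  have h2 := neg_one_div_re_neg b.2.1
  rw [← this] at h2
  exact h2.ne ha

lemma mem_nonzeroPoles_neg_one_div_iff (hq : IsRPF p k q) (a : ℂ) :
    -1 / a ∈ nonzeroPoles q ↔ a ∈ nonzeroPoles q := by
  constructor
  · rintro ⟨h0, h⟩
    have := hq.isRoot_neg_one_div h0 h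
    rw [neg_one_div_neg_one_div] at this
    refine ⟨fun h => ?_, this⟩
    simp [h] at h0
  · rintro ⟨h0, h⟩
    exact ⟨neg_one_div_ne_zero h0, hq.isRoot_neg_one_div h0 h⟩

end

/-! ### The contractions of the right half-plane and their products -/

/-- For a digit `i` (with `0 ≤ i < p - 1`), the matrix `-U ^ (i + 1) T`. Its entries are
nonnegative, and its Möbius transformation maps the right half-plane into itself. -/
noncomputable def digitMatrix (p : ℕ) (i : Fin (p - 1)) : Matrix.SpecialLinearGroup (Fin 2) ℝ :=
  -(heckeU p ^ ((i : ℕ) + 1) * heckeT)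

/-- The shift on one-sided sequences. -/
def shift {A : Type*} (y : ℕ → A) : ℕ → A := fun n => y (n + 1)

@[simp] lemma shift_apply {A : Type*} (y : ℕ → A) (n : ℕ) : shift y n = y (n + 1) := rfl

lemma shift_iterate_apply {A : Type*} (y : ℕ → A) (m n : ℕ) : (shift^[m] y) n = y (n + m) := by
  induction m generalizing y with
  | zero => rfl
  | succ m ih =>
    rw [iterate_succ_apply, ih, shift_apply]
    congr 1

/-- The product of the digit matrices of `y 0, …, y (n - 1)`. -/
noncomputable def wordMatrix {p : ℕ} (y : ℕ → Fin (p - 1)) :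
    ℕ → Matrix.SpecialLinearGroup (Fin 2) ℝ
  | 0 => 1
  | n + 1 => digitMatrix p (y 0) * wordMatrix (shift y) n

/-- Real matrices of determinant one with positive diagonal and nonnegative entries. -/
structure IsNonneg (M : Matrix.SpecialLinearGroup (Fin 2) ℝ) : Prop where
  pos₀₀ : 0 < M 0 0
  pos₁₁ : 0 < M 1 1
  nonneg₀₁ : 0 ≤ M 0 1
  nonneg₁₀ : 0 ≤ M 1 0

section

variable {p : ℕ} {M N : Matrix.SpecialLinearGroup (Fin 2) ℝ}

lemma mul_entries (M N : Matrix.SpecialLinearGroup (Fin 2) ℝ) :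
    (M * N) 0 0 = M 0 0 * N 0 0 + M 0 1 * N 1 0 ∧ (M * N) 0 1 = M 0 0 * N 0 1 + M 0 1 * N 1 1 ∧
    (M * N) 1 0 = M 1 0 * N 0 0 + M 1 1 * N 1 0 ∧
    (M * N) 1 1 = M 1 0 * N 0 1 + M 1 1 * N 1 1 := by
  simp [Matrix.mul_apply, Fin.sum_univ_two]

lemma IsNonneg.mul (hM : IsNonneg M) (hN : IsNonneg N) : IsNonneg (M * N) := by
  obtain ⟨a, b, c, d⟩ := hM
  obtain ⟨a', b', c', d'⟩ := hN
  obtain ⟨h1, h2, h3, h4⟩ := mul_entries M N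
  constructor <;> simp only [h1, h2, h3, h4] <;> positivity

lemma isNonneg_one : IsNonneg 1 := by constructor <;> simp

lemma IsNonneg.den_ne_zero (hM : IsNonneg M) {z : ℂ} (hz : 0 < z.re) : den M z ≠ 0 := by
  intro h
  have := congrArg Complex.re h
  simp [den] at this
  have h1 := hM.pos₁₁
  have h2 := mul_nonneg hM.nonneg₁₀ hz.le
  linarith

lemma IsNonneg.fixed_iff (hM : IsNonneg M) {z : ℂ} (hz : 0 < z.re) :
    mob M z = z ↔ ((M 1 0 : ℝ) : ℂ) * z * z + (((M 1 1 : ℝ) : ℂ) - ((M 0 0 : ℝ) : ℂ)) * z -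
      ((M 0 1 : ℝ) : ℂ) = 0 := by
  rw [mob, div_eq_iff (hM.den_ne_zero hz), den]
  constructor <;> intro h <;> linear_combination -h

/-- A nonnegative matrix other than the identity has at most one fixed point in the right
half-plane: the roots of its fixed point equation have a product which is not positive. -/
lemma IsNonneg.fixed_unique (hM : IsNonneg M) (h : 0 < M 0 1 + M 1 0) {z w : ℂ} (hz : 0 < z.re)
    (hw : 0 < w.re) (h1 : mob M z = z) (h2 : mob M w = w) : z = w := by
  rw [hM.fixed_iff hz] at h1
  rw [hM.fixed_iff hw] at h2
  by_contra hne
  have hs : ((M 1 0 : ℝ) : ℂ) * (z + w) + (((M 1 1 : ℝ) : ℂ) - ((M 0 0 : ℝ) : ℂ)) = 0 := by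
    apply mul_left_cancel₀ (sub_ne_zero.mpr hne)
    linear_combination h1 - h2
  have hp : ((M 1 0 : ℝ) : ℂ) * (z * w) + ((M 0 1 : ℝ) : ℂ) = 0 := by
    linear_combination hs * z - h1
  have s2 := congrArg Complex.im hs
  have p1 := congrArg Complex.re hp
  simp only [Complex.add_re, Complex.add_im, Complex.sub_im, Complex.mul_re, Complex.mul_im,
    Complex.ofReal_re, Complex.ofReal_im, Complex.zero_re, Complex.zero_im] at s2 p1
  have hb := hM.nonneg₀₁
  have hc := hM.nonneg₁₀
  rcases hc.eq_or_lt with hc | hc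
  · rw [← hc] at p1 h
    linarith
  · have him : w.im = -z.im := by
      have : M 1 0 * (z.im + w.im) = 0 := by linarith
      rcases mul_eq_zero.mp this with h | h
      · exact absurd h hc.ne'
      · linarith
    rw [him] at p1
    have := mul_pos hc (mul_pos hz hw)
    have := mul_nonneg hc.le (mul_self_nonneg z.im)
    nlinarith

lemma IsNonneg.exists_fixed (hM : IsNonneg M) (hb : 0 < M 0 1) (hc : 0 < M 1 0) :
    ∃ x : ℝ, 0 < x ∧ mob M x = x := by
  have hD : 0 < (M 0 0 - M 1 1) ^ 2 + 4 * M 0 1 * M 1 0 := by positivity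
  set s := √((M 0 0 - M 1 1) ^ 2 + 4 * M 0 1 * M 1 0)
  have hs : s * s = (M 0 0 - M 1 1) ^ 2 + 4 * M 0 1 * M 1 0 := Real.mul_self_sqrt hD.le
  have hlt : |M 0 0 - M 1 1| < s := by
    rw [← Real.sqrt_sq_eq_abs]
    exact Real.sqrt_lt_sqrt (sq_nonneg _) (by linarith [mul_pos hb hc])
  have hx : 0 < ((M 0 0 - M 1 1) + s) / (2 * M 1 0) :=
    div_pos (by linarith [neg_abs_le (M 0 0 - M 1 1)]) (by linarith)
  refine ⟨_, hx, ?_⟩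
  rw [hM.fixed_iff (by rwa [Complex.ofReal_re])]
  norm_cast
  have := hc.ne'
  field_simp
  linear_combination hs

lemma digitMatrix_entries (hp : 3 ≤ p) (i : Fin (p - 1)) :
    (digitMatrix p i) 0 0 = sn p (i + 1) ∧ (digitMatrix p i) 0 1 = sn p (i + 2) ∧
    (digitMatrix p i) 1 0 = sn p i ∧ (digitMatrix p i) 1 1 = sn p (i + 1) := by
  obtain ⟨h1, h2, h3, h4⟩ := heckeU_pow_entries hp (i : ℕ)
  obtain ⟨e1, e2, e3, e4⟩ := mul_entries (heckeU p ^ ((i : ℕ) + 1)) heckeT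
  simp only [digitMatrix, Matrix.SpecialLinearGroup.coe_neg, Matrix.neg_apply, e1, e2, e3, e4, h1,
    h2, h3, h4]
  simp [heckeT]

lemma isNonneg_digitMatrix (hp : 3 ≤ p) (i : Fin (p - 1)) : IsNonneg (digitMatrix p i) := by
  obtain ⟨h1, h2, h3, h4⟩ := digitMatrix_entries hp i
  have hi := i.2
  have := sn_pos hp (j := i + 1) (by omega) (by omega)
  exact ⟨h1 ▸ this, h4 ▸ this, h2 ▸ sn_nonneg hp (by omega), h3 ▸ sn_nonneg hp (by omega)⟩

lemma mob_digitMatrix (i : Fin (p - 1)) {z : ℂ} (hz : z ≠ 0) :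
    mob (digitMatrix p i) z = mob (heckeU p ^ ((i : ℕ) + 1)) (-1 / z) := by
  rw [digitMatrix, mob_neg, mob_mul _ _ (by simpa using hz), mob_heckeT]

lemma mob_digitMatrix_re_pos (hp : 3 ≤ p) (i : Fin (p - 1)) {z : ℂ} (hz : 0 < z.re) :
    0 < (mob (digitMatrix p i) z).re := by
  have h0 := ne_zero_of_re_pos hz
  have := i.2
  rw [mob_digitMatrix i h0]
  exact mob_heckeU_pow_re_pos hp (neg_one_div_re_neg hz).le (neg_one_div_ne_zero h0) (by omega)
    (by omega)

lemma mob_digitMatrix_inj (hp : 3 ≤ p) {i j : Fin (p - 1)} {z w : ℂ} (hz : 0 < z.re)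
    (hw : 0 < w.re) (h : mob (digitMatrix p i) z = mob (digitMatrix p j) w) : i = j ∧ z = w := by
  have z0 := ne_zero_of_re_pos hz
  have w0 := ne_zero_of_re_pos hw
  have := i.2
  have := j.2
  rw [mob_digitMatrix i z0, mob_digitMatrix j w0] at h
  obtain ⟨h1, h2⟩ := eq_of_mob_heckeU_pow_eq hp (neg_one_div_re_neg hz).le (neg_one_div_ne_zero z0)
    (neg_one_div_re_neg hw).le (neg_one_div_ne_zero w0) (by omega) (by omega) h
  refine ⟨Fin.ext (by omega), ?_⟩
  have h3 := congrArg (fun z : ℂ => -1 / z) h2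
  simpa only [neg_one_div_neg_one_div] using h3

lemma isNonneg_wordMatrix (hp : 3 ≤ p) (y : ℕ → Fin (p - 1)) (n : ℕ) :
    IsNonneg (wordMatrix y n) := by
  induction n generalizing y with
  | zero => exact isNonneg_one
  | succ n ih => exact (isNonneg_digitMatrix hp _).mul (ih _)

lemma wordMatrix_pos₀₁ (hp : 3 ≤ p) {y : ℕ → Fin (p - 1)} {n i : ℕ} (hi : i < n)
    (h : (y i : ℕ) ≠ p - 2) : 0 < wordMatrix y n 0 1 := by
  induction n generalizing y i with
  | zero => omega
  | succ n ih =>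
    obtain ⟨a, b, c, d⟩ := isNonneg_digitMatrix hp (y 0)
    obtain ⟨a', b', c', d'⟩ := isNonneg_wordMatrix hp (shift y) n
    rw [wordMatrix, (mul_entries _ _).2.1]
    rcases i with _ | i
    · have : 0 < digitMatrix p (y 0) 0 1 := by
        rw [(digitMatrix_entries hp (y 0)).2.1]
        have := (y 0).2
        exact sn_pos hp (by omega) (by omega)
      positivity
    · have := ih (y := shift y) (i := i) (by omega) h
      positivity

lemma wordMatrix_pos₁₀ (hp : 3 ≤ p) {y : ℕ → Fin (p - 1)} {n i : ℕ} (hi : i < n)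
    (h : (y i : ℕ) ≠ 0) : 0 < wordMatrix y n 1 0 := by
  induction n generalizing y i with
  | zero => omega
  | succ n ih =>
    obtain ⟨a, b, c, d⟩ := isNonneg_digitMatrix hp (y 0)
    obtain ⟨a', b', c', d'⟩ := isNonneg_wordMatrix hp (shift y) n
    rw [wordMatrix, (mul_entries _ _).2.2.1]
    rcases i with _ | i
    · have : 0 < digitMatrix p (y 0) 1 0 := by
        rw [(digitMatrix_entries hp (y 0)).2.2.1]
        have := (y 0).2
        exact sn_pos hp (by omega) (by omega)
      positivity
    · have := ih (y := shift y) (i := i) (by omega) h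
      positivity

lemma mob_wordMatrix_of_chain (hp : 3 ≤ p) {y : ℕ → Fin (p - 1)} {a : ℕ → ℂ}
    (ha : ∀ n, 0 < (a n).re) (h : ∀ n, a n = mob (digitMatrix p (y n)) (a (n + 1))) (n : ℕ) :
    mob (wordMatrix y n) (a n) = a 0 := by
  induction n generalizing y a with
  | zero => simp [wordMatrix]
  | succ n ih =>
    have := ih (y := shift y) (a := fun n => a (n + 1)) (fun n => ha _) (fun n => h _)
    rw [wordMatrix, mob_mul _ _ ((isNonneg_wordMatrix hp _ _).den_ne_zero (ha _)), this, h 0]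

/-! ### Coding by periodic sequences -/

/-- The shift-periodic sequences of digits, except the two constant ones whose digit matrix is
parabolic: `S` for the digit `0`, and the conjugate of `S⁻¹` by `T` for the digit `p - 2`. -/
def codes (p : ℕ) : Set (ℕ → Fin (p - 1)) :=
  {y | y ∈ periodicPts (shift (A := Fin (p - 1))) ∧ (∃ n, (y n : ℕ) ≠ 0) ∧
    ∃ n, (y n : ℕ) ≠ p - 2}

lemma apply_mod_of_isPeriodicPt {A : Type*} {y : ℕ → A} {n : ℕ} (h : IsPeriodicPt shift n y)
    (i : ℕ) : y (i % n) = y i := by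
  have h1 := congrFun (h.iterate_mod_apply i) 0
  rwa [shift_iterate_apply, shift_iterate_apply, zero_add, zero_add] at h1

lemma exists_lt_of_periodic {A : Type*} {y : ℕ → A} {N : ℕ} (hN : 0 < N)
    (h : IsPeriodicPt shift N y) {P : A → Prop} (hP : ∃ n, P (y n)) : ∃ n < N, P (y n) := by
  obtain ⟨n, hn⟩ := hP
  exact ⟨n % N, Nat.mod_lt _ hN, by rwa [apply_mod_of_isPeriodicPt h]⟩

lemma wordMatrix_pos (hp : 3 ≤ p) {y : ℕ → Fin (p - 1)} (hy : y ∈ codes p) {N : ℕ} (hN : 0 < N)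
    (h : IsPeriodicPt shift N y) : 0 < wordMatrix y N 0 1 ∧ 0 < wordMatrix y N 1 0 := by
  obtain ⟨i, hi, hi'⟩ := exists_lt_of_periodic hN h (P := fun d => (d : ℕ) ≠ p - 2) hy.2.2
  obtain ⟨j, hj, hj'⟩ := exists_lt_of_periodic hN h (P := fun d => (d : ℕ) ≠ 0) hy.2.1
  exact ⟨wordMatrix_pos₀₁ hp hi hi', wordMatrix_pos₁₀ hp hj hj'⟩

lemma shift_mem_codes {y : ℕ → Fin (p - 1)} (hy : y ∈ codes p) : shift y ∈ codes p := by
  obtain ⟨hper, h1, h2⟩ := hy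
  obtain ⟨N, hN, h⟩ := hper
  have key : ∀ P : Fin (p - 1) → Prop, (∃ n, P (y n)) → ∃ n, P (shift y n) := by
    rintro P ⟨n, hn⟩
    refine ⟨n + N - 1, ?_⟩
    have := congrFun h n
    rw [shift_iterate_apply] at this
    rw [shift_apply, show n + N - 1 + 1 = n + N by omega, this]
    exact hn
  exact ⟨⟨N, hN, h.apply⟩, key (fun d => (d : ℕ) ≠ 0) h1, key (fun d => (d : ℕ) ≠ p - 2) h2⟩

lemma iterate_shift_mem_codes {y : ℕ → Fin (p - 1)} (hy : y ∈ codes p) (n : ℕ) :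
    shift^[n] y ∈ codes p := by
  induction n with
  | zero => exact hy
  | succ n ih =>
    rw [iterate_succ_apply']
    exact shift_mem_codes ih

/-- The positive real number with periodic expansion `y`: the positive fixed point of the product
of the digit matrices over one period. -/
noncomputable def codePoint (y : ℕ → Fin (p - 1)) : ℝ :=
  Classical.epsilon fun x : ℝ => 0 < x ∧ mob (wordMatrix y (minimalPeriod shift y)) x = x

lemma codePoint_spec (hp : 3 ≤ p) {y : ℕ → Fin (p - 1)} (hy : y ∈ codes p) :
    0 < codePoint y ∧ mob (wordMatrix y (minimalPeriod shift y)) (codePoint y) = codePoint y := by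
  obtain ⟨hb, hc⟩ := wordMatrix_pos hp hy (minimalPeriod_pos_of_mem_periodicPts hy.1)
    (isPeriodicPt_minimalPeriod _ _)
  exact Classical.epsilon_spec ((isNonneg_wordMatrix hp _ _).exists_fixed hb hc)

lemma eq_codePoint_of_fixed (hp : 3 ≤ p) {y : ℕ → Fin (p - 1)} (hy : y ∈ codes p) {z : ℂ}
    (hz : 0 < z.re) (h : mob (wordMatrix y (minimalPeriod shift y)) z = z) :
    z = codePoint y := by
  obtain ⟨hb, hc⟩ := wordMatrix_pos hp hy (minimalPeriod_pos_of_mem_periodicPts hy.1)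
    (isPeriodicPt_minimalPeriod _ _)
  obtain ⟨h1, h2⟩ := codePoint_spec hp hy
  exact (isNonneg_wordMatrix hp _ _).fixed_unique (by linarith) hz (by simpa using h1) h h2

lemma wordMatrix_succ' (y : ℕ → Fin (p - 1)) (n : ℕ) :
    wordMatrix y (n + 1) = wordMatrix y n * digitMatrix p (y n) := by
  induction n generalizing y with
  | zero => simp [wordMatrix]
  | succ n ih =>
    rw [wordMatrix, ih (shift y), ← mul_assoc]
    rfl

/-- Both `codePoint (shift y)` and its image under the first digit are fixed points, of the two
cyclic rotations of the word of `y`. -/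
lemma codePoint_eq (hp : 3 ≤ p) {y : ℕ → Fin (p - 1)} (hy : y ∈ codes p) :
    (codePoint y : ℂ) = mob (digitMatrix p (y 0)) (codePoint (shift y)) := by
  obtain ⟨h1, h2⟩ := codePoint_spec hp (shift_mem_codes hy)
  have hz : 0 < ((codePoint (shift y) : ℝ) : ℂ).re := by simpa using h1
  have hz' := mob_digitMatrix_re_pos hp (y 0) hz
  refine (eq_codePoint_of_fixed hp hy hz' ?_).symm
  rw [minimalPeriod_apply hy.1] at h2
  have hN := minimalPeriod_pos_of_mem_periodicPts hy.1
  obtain ⟨N, hNe⟩ : ∃ N, minimalPeriod shift y = N + 1 := ⟨_, (Nat.succ_pred_eq_of_pos hN).symm⟩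
  have hlast : shift y N = y 0 := by
    have := congrFun (isPeriodicPt_minimalPeriod shift y) 0
    rw [shift_iterate_apply, hNe, zero_add] at this
    exact this
  rw [hNe] at h2 ⊢
  rw [wordMatrix_succ', hlast, mob_mul _ _ ((isNonneg_digitMatrix hp _).den_ne_zero hz)] at h2
  rw [wordMatrix, mob_mul _ _ ((isNonneg_wordMatrix hp _ _).den_ne_zero hz'), h2]

lemma codePoint_injOn (hp : 3 ≤ p) : Set.InjOn (codePoint (p := p)) (codes p) := by
  have key : ∀ n, ∀ y ∈ codes p, ∀ y' ∈ codes p, codePoint y = codePoint y' → y n = y' n := by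
    intro n
    induction n with
    | zero =>
      intro y hy y' hy' h
      have h1 := codePoint_eq hp hy
      rw [h, codePoint_eq hp hy'] at h1
      exact (mob_digitMatrix_inj hp (by simpa using (codePoint_spec hp (shift_mem_codes hy')).1)
        (by simpa using (codePoint_spec hp (shift_mem_codes hy)).1) h1).1.symm
    | succ n ih =>
      intro y hy y' hy' h
      have h1 := codePoint_eq hp hy
      rw [h, codePoint_eq hp hy'] at h1
      have h2 := (mob_digitMatrix_inj hp
        (by simpa using (codePoint_spec hp (shift_mem_codes hy')).1)
        (by simpa using (codePoint_spec hp (shift_mem_codes hy)).1) h1).2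
      exact ih _ (shift_mem_codes hy) _ (shift_mem_codes hy') (by exact_mod_cast h2.symm)
  intro y hy y' hy' h
  funext n
  exact key n y hy y' hy' h

lemma heckeLambda_pos (hp : 3 ≤ p) : 0 < heckeLambda p := by
  have h := sn_add_two p 0
  rw [zero_add, sn_one hp, sn_zero] at h
  have := sn_pos hp (j := 2) (by omega) (by omega)
  linarith

lemma not_periodic_of_eq_add {u : ℕ → ℝ} {c : ℝ} (hc : 0 < c) (h : ∀ n, u n = u (n + 1) + c)
    {N : ℕ} (hN : 0 < N) (hu : u N = u 0) : False := by
  have := strictAnti_nat_of_succ_lt (f := u) (fun n => by linarith [h n])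
  exact (this hN).ne hu

lemma mob_digitMatrix_of_eq_zero (hp : 3 ≤ p) {i : Fin (p - 1)} (hi : (i : ℕ) = 0) (z : ℂ) :
    mob (digitMatrix p i) z = z + heckeLambda p := by
  obtain ⟨h1, h2, h3, h4⟩ := digitMatrix_entries hp i
  have h := sn_add_two p 0
  rw [hi] at h1 h2 h3 h4
  rw [mob, den, h1, h2, h3, h4, h]
  simp [sn_one hp]

lemma mob_digitMatrix_of_eq_last (hp : 3 ≤ p) {i : Fin (p - 1)} (hi : (i : ℕ) = p - 2) {z : ℂ}
    (hz : 0 < z.re) : (mob (digitMatrix p i) z)⁻¹ = z⁻¹ + heckeLambda p := by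
  obtain ⟨h1, h2, h3, h4⟩ := digitMatrix_entries hp i
  have h := sn_add_two p (i : ℕ)
  have e : (i : ℕ) + 2 = p := by omega
  have hd := det_eq (digitMatrix p i)
  have hpos := (isNonneg_digitMatrix hp i).pos₀₀
  rw [h1, h2, h3, h4, e, sn_self hp, zero_mul, sub_zero] at hd
  rw [h1] at hpos
  have h11 : sn p (i + 1) = 1 := by nlinarith
  rw [e, sn_self hp, h11] at h
  have hi' : sn p i = heckeLambda p := by linarith
  have := ne_zero_of_re_pos hz
  rw [mob, den, h1, h2, h3, h4, h11, hi', e, sn_self hp]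
  simp
  field_simp
  ring

/-- A periodic chain of points of the right half-plane consists of the points coded by its
sequence of digits. -/
lemma eq_codePoint_of_chain (hp : 3 ≤ p) {y : ℕ → Fin (p - 1)} {a : ℕ → ℂ}
    (ha : ∀ n, 0 < (a n).re) (h : ∀ n, a n = mob (digitMatrix p (y n)) (a (n + 1))) {N : ℕ}
    (hN : 0 < N) (hy : ∀ n, y (n + N) = y n) (haN : ∀ n, a (n + N) = a n) :
    y ∈ codes p ∧ ∀ n, a n = codePoint (shift^[n] y) := by
  have hper : IsPeriodicPt shift N y := by
    funext n
    rw [shift_iterate_apply, hy]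
  have hcode : y ∈ codes p := by
    refine ⟨⟨N, hN, hper⟩, ?_, ?_⟩
    -- along a constant sequence one of the two parabolic matrices translates `a n`, respectively
    -- `(a n)⁻¹`, by `λ_p`
    · by_contra! h0
      refine not_periodic_of_eq_add (u := fun n => (a n).re) (heckeLambda_pos hp) (fun n => ?_) hN
        (by simpa using congrArg Complex.re (haN 0))
      have := congrArg Complex.re (h n)
      rw [mob_digitMatrix_of_eq_zero hp (h0 n)] at this
      simpa using this
    · by_contra! h0
      refine not_periodic_of_eq_add (u := fun n => ((a n)⁻¹).re) (heckeLambda_pos hp)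
        (fun n => ?_) hN (by
          have := congrArg (fun z : ℂ => z⁻¹.re) (haN 0)
          rwa [zero_add] at this)
      have := congrArg (fun z : ℂ => z⁻¹.re) (h n)
      simp only [mob_digitMatrix_of_eq_last hp (h0 n) (ha _)] at this
      simpa using this
  refine ⟨hcode, ?_⟩
  have main : a 0 = codePoint y := by
    obtain ⟨hb, hc⟩ := wordMatrix_pos hp hcode hN hper
    have h1 := mob_wordMatrix_of_chain hp ha h N
    have haN0 := haN 0
    rw [zero_add] at haN0
    rw [haN0] at h1
    have h2 := mob_wordMatrix_of_chain hp (y := y) (a := fun n => (codePoint (shift^[n] y) : ℂ))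
      (fun n => by simpa using (codePoint_spec hp (iterate_shift_mem_codes hcode n)).1)
      (fun n => by
        rw [codePoint_eq hp (iterate_shift_mem_codes hcode n), iterate_succ_apply',
          shift_iterate_apply, zero_add]) N
    simp only [hper.eq, iterate_zero, id] at h2
    exact (isNonneg_wordMatrix hp _ _).fixed_unique (by linarith) (ha 0)
      (by simpa using (codePoint_spec hp hcode).1) h1 h2
  intro n
  induction n with
  | zero => exact main
  | succ n ih =>
    have h1 := codePoint_eq hp (iterate_shift_mem_codes hcode n)
    rw [← ih, h n, shift_iterate_apply, zero_add, ← iterate_succ_apply' shift] at h1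
    exact (mob_digitMatrix_inj hp (ha _)
      (by simpa using (codePoint_spec hp (iterate_shift_mem_codes hcode (n + 1))).1) h1).2

/-- The set of poles attached to a code: the points coded by its shifts, and their images under
`T`. -/
def codePoles (y : ℕ → Fin (p - 1)) : Set ℂ :=
  {b | ∃ n, b = (codePoint (shift^[n] y) : ℂ) ∨ b = -1 / (codePoint (shift^[n] y) : ℂ)}

lemma IsRPF.exists_code_of_re_pos {k : ℕ} {q : RatFunc ℂ} (hp : 3 ≤ p) (hq : IsRPF p k q) {a : ℂ}
    (ha : 0 < a.re) (h : q.denom.IsRoot a) :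
    ∃ y ∈ codes p, a = codePoint y ∧
      ∀ n, (codePoint (shift^[n] y) : ℂ) ∈ nonzeroPoles q := by
  obtain ⟨e, d, hd⟩ := hq.exists_perm hp
  have : Finite (rightPoles q) := (finite_rightPoles q).to_subtype
  -- follow the permutation of the right poles backwards from `a`
  let a₀ : rightPoles q := ⟨a, ha, h⟩
  let α : ℕ → rightPoles q := fun n => (⇑e.symm)^[n] a₀
  have hα : ∀ n, e (α (n + 1)) = α n := by
    intro n
    simp only [α, iterate_succ_apply', Equiv.apply_symm_apply]
  obtain ⟨N, hN, hper⟩ := e.symm.injective.mem_periodicPts a₀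
  have hαN : ∀ n, α (n + N) = α n := by
    intro n
    simp only [α, iterate_add_apply, hper.eq]
  let y : ℕ → Fin (p - 1) := fun n => ⟨d (α (n + 1)) - 1, by have := hd (α (n + 1)); omega⟩
  obtain ⟨hy, hchain⟩ := eq_codePoint_of_chain hp (y := y) (a := fun n => (α n : ℂ))
    (fun n => (α n).2.1) (fun n => by
      obtain ⟨h0, h1, h2⟩ := hd (α (n + 1))
      rw [← hα n, h2, mob_digitMatrix _ (ne_zero_of_re_pos (α (n + 1)).2.1)]
      congr 2
      simp only [y]
      omega) hN (fun n => by simp only [y, show n + N + 1 = n + 1 + N by omega, hαN])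
    (fun n => by rw [hαN])
  refine ⟨y, hy, hchain 0, fun n => ?_⟩
  rw [← hchain n]
  exact ⟨ne_zero_of_re_pos (α n).2.1, (α n).2.2⟩

end

/-! ### A rational period function of weight two for each code -/

lemma eventually_isRoot_ne (q : RatFunc ℂ) : ∀ᶠ z in cofinite, q.denom.eval z ≠ 0 := by
  rw [eventually_cofinite]
  simpa using finite_isRoot q

lemma toFun_add (q r : RatFunc ℂ) : ∀ᶠ z in cofinite, toFun (q + r) z = toFun q z + toFun r z := by
  filter_upwards [eventually_isRoot_ne q, eventually_isRoot_ne r] with z h1 h2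
  exact RatFunc.eval_add _ _ h1 h2

lemma toFun_mul (q r : RatFunc ℂ) : ∀ᶠ z in cofinite, toFun (q * r) z = toFun q z * toFun r z := by
  filter_upwards [eventually_isRoot_ne q, eventually_isRoot_ne r] with z h1 h2
  exact RatFunc.eval_mul _ _ h1 h2

lemma toFun_sum {ι : Type*} (s : Finset ι) (q : ι → RatFunc ℂ) :
    ∀ᶠ z in cofinite, toFun (∑ i ∈ s, q i) z = ∑ i ∈ s, toFun (q i) z := by
  classical
  induction s using Finset.induction_on with
  | empty => simp [toFun]
  | insert i s hi ih =>
    filter_upwards [ih, toFun_add (q i) (∑ i ∈ s, q i)] with z h1 h2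
    rw [Finset.sum_insert hi, Finset.sum_insert hi, h2, h1]

lemma toFun_C (c z : ℂ) : toFun (RatFunc.C c) z = c := by simp [toFun]

lemma toFun_inv_X_sub_C (a : ℂ) :
    ∀ᶠ z in cofinite, toFun (RatFunc.X - RatFunc.C a)⁻¹ z = (z - a)⁻¹ := by
  have hne : (RatFunc.X - RatFunc.C a : RatFunc ℂ) ≠ 0 := by
    rw [← RatFunc.algebraMap_X, ← RatFunc.algebraMap_C, ← map_sub]
    exact RatFunc.algebraMap_ne_zero (Polynomial.X_sub_C_ne_zero a)
  filter_upwards [toFun_mul (RatFunc.X - RatFunc.C a) (RatFunc.X - RatFunc.C a)⁻¹,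
    toFun_add RatFunc.X (RatFunc.C (-a))] with z h1 h2
  rw [mul_inv_cancel₀ hne] at h1
  rw [sub_eq_add_neg, ← map_neg] at h1 ⊢
  rw [h2, toFun_C] at h1
  have hX : toFun RatFunc.X z = z := by simp [toFun]
  have h_one : toFun 1 z = 1 := by simp [toFun]
  rw [hX, h_one] at h1
  rw [← sub_eq_add_neg] at h1
  exact eq_inv_of_mul_eq_one_right h1.symm

/-- The rational function `∑ i < N, (1 / (z - x i) - 1 / (z - w i))`: the logarithmic derivative of
`∏ i < N, (z - x i) / (z - w i)`. -/
noncomputable def logDerivRat (N : ℕ) (x w : ℕ → ℂ) : RatFunc ℂ :=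
  ∑ i ∈ Finset.range N, ((RatFunc.X - RatFunc.C (x i))⁻¹ +
    RatFunc.C (-1) * (RatFunc.X - RatFunc.C (w i))⁻¹)

lemma toFun_logDerivRat (N : ℕ) (x w : ℕ → ℂ) :
    ∀ᶠ z in cofinite, toFun (logDerivRat N x w) z =
      ∑ i ∈ Finset.range N, ((z - x i)⁻¹ - (z - w i)⁻¹) := by
  have h2 : ∀ᶠ z in cofinite, ∀ i ∈ Finset.range N,
      toFun ((RatFunc.X - RatFunc.C (x i))⁻¹ + RatFunc.C (-1) * (RatFunc.X - RatFunc.C (w i))⁻¹) z =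
        (z - x i)⁻¹ - (z - w i)⁻¹ := by
    rw [Filter.eventually_all_finset]
    intro i _
    filter_upwards [toFun_add (RatFunc.X - RatFunc.C (x i))⁻¹
      (RatFunc.C (-1) * (RatFunc.X - RatFunc.C (w i))⁻¹), toFun_inv_X_sub_C (x i),
      toFun_inv_X_sub_C (w i), toFun_mul (RatFunc.C (-1)) (RatFunc.X - RatFunc.C (w i))⁻¹]
      with z h1 h2 h3 h4
    rw [h1, h2, h4, h3, toFun_C]
    ring
  filter_upwards [toFun_sum (Finset.range N) fun i => (RatFunc.X - RatFunc.C (x i))⁻¹ +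
    RatFunc.C (-1) * (RatFunc.X - RatFunc.C (w i))⁻¹, h2] with z h h2
  rw [logDerivRat, h]
  exact Finset.sum_congr rfl h2

lemma tendsto_inv_sub_cobounded (a : ℂ) :
    Tendsto (fun z => (z - a)⁻¹) (𝓝[≠] a) (Bornology.cobounded ℂ) := by
  refine tendsto_inv₀_nhdsNE_zero.comp (tendsto_nhdsWithin_iff.mpr ⟨?_, ?_⟩)
  · have : Tendsto (fun z : ℂ => z - a) (𝓝 a) (𝓝 (a - a)) :=
      (continuous_id.sub continuous_const).tendsto a
    rw [sub_self] at this
    exact this.mono_left nhdsWithin_le_nhds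
  · filter_upwards [self_mem_nhdsWithin] with z hz
    exact sub_ne_zero.mpr hz

lemma continuousAt_inv_sub {a b : ℂ} (h : a ≠ b) : ContinuousAt (fun z => (z - b)⁻¹) a :=
  ContinuousAt.inv₀ (by fun_prop) (sub_ne_zero.mpr h)

/-- A rational function agreeing off a finite set with `c / (z - a)` up to a function continuous
at `a` has a pole at `a` when `c ≠ 0`. -/
lemma isRoot_of_eq_add {q : RatFunc ℂ} {a c : ℂ} {g : ℂ → ℂ} (hc : c ≠ 0) (hg : ContinuousAt g a)
    (h : ∀ᶠ z in cofinite, toFun q z = c * (z - a)⁻¹ + g z) : q.denom.IsRoot a := by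
  by_contra hn
  refine not_tendsto_cobounded_of_add_eq_zero (f := fun z => (z - a)⁻¹) (a := a)
    (g := fun z => c⁻¹ * (g z - toFun q z))
    (continuousAt_const.mul (hg.sub (continuousAt_toFun hn))) ?_ (tendsto_inv_sub_cobounded a)
  filter_upwards [h] with z hz
  rw [hz]
  field_simp
  ring

lemma not_isRoot_of_eq {q : RatFunc ℂ} {a : ℂ} {g : ℂ → ℂ} (hg : ContinuousAt g a)
    (h : ∀ᶠ z in cofinite, toFun q z = g z) : ¬q.denom.IsRoot a := by
  intro hr
  refine not_tendsto_cobounded_of_add_eq_zero (g := fun z => -g z) hg.neg ?_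
    (tendsto_toFun_of_isRoot hr)
  filter_upwards [h] with z hz
  rw [hz, add_neg_cancel]

lemma not_isRoot_logDerivRat {N : ℕ} {x w : ℕ → ℂ} {a : ℂ} (hx : ∀ i < N, a ≠ x i)
    (hw : ∀ i < N, a ≠ w i) : ¬(logDerivRat N x w).denom.IsRoot a := by
  refine not_isRoot_of_eq ?_ (toFun_logDerivRat N x w)
  refine tendsto_finsetSum _ fun i hi => ?_
  have hi := Finset.mem_range.mp hi
  exact (continuousAt_inv_sub (hx i hi)).sub (continuousAt_inv_sub (hw i hi))

lemma isRoot_logDerivRat {N : ℕ} {x w : ℕ → ℂ} {a : ℂ} {i : ℕ} (hi : i < N) (ha : a = x i)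
    (hx : ∀ j < N, j ≠ i → x j ≠ x i) (hw : ∀ j < N, x i ≠ w j) :
    (logDerivRat N x w).denom.IsRoot a := by
  subst ha
  refine isRoot_of_eq_add (c := 1) (g := fun z =>
    (∑ j ∈ (Finset.range N).erase i, ((z - x j)⁻¹ - (z - w j)⁻¹)) - (z - w i)⁻¹) one_ne_zero ?_ ?_
  · refine ContinuousAt.sub (tendsto_finsetSum _ fun j hj => ?_) (continuousAt_inv_sub (hw i hi))
    rw [Finset.mem_erase, Finset.mem_range] at hj
    exact (continuousAt_inv_sub (hx j hj.2 hj.1).symm).sub (continuousAt_inv_sub (hw j hj.2))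
  · filter_upwards [toFun_logDerivRat N x w] with z hz
    rw [hz, ← Finset.add_sum_erase _ _ (Finset.mem_range.mpr hi)]
    ring

/-- The weight two slash operator acts on `1 / (z - x)` as on the logarithmic differential
`dz / (z - x)`, up to a term not depending on `x`. -/
lemma slash_inv_sub (M : Matrix.SpecialLinearGroup (Fin 2) ℝ) {x z : ℂ} (hx : den M x ≠ 0)
    (hz : den M z ≠ 0) (hzx : z ≠ x) :
    den M z ^ (-(2 * ((1 : ℕ) : ℤ))) * (mob M z - mob M x)⁻¹ =
      (z - x)⁻¹ - ((M 1 0 : ℝ) : ℂ) / den M z := by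
  have h : den M x = den M z - ((M 1 0 : ℝ) : ℂ) * (z - x) := by
    simp only [den]
    ring
  have hne := sub_ne_zero.mpr hzx
  rw [mob_sub_mob M hz hx, inv_div, show (-(2 * ((1 : ℕ) : ℤ))) = -((2 : ℕ) : ℤ) by norm_num,
    zpow_neg, zpow_natCast]
  field_simp
  linear_combination h

lemma eventually_slash_congr {f g : ℂ → ℂ} (h : ∀ᶠ z in cofinite, f z = g z) (k : ℕ)
    (M : Matrix.SpecialLinearGroup (Fin 2) ℝ) :
    ∀ᶠ z in cofinite, slash k f M z = slash k g M z := by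
  filter_upwards [(tendsto_mob_cofinite M).eventually h] with z hz
  rw [slash_eq, slash_eq, hz]

/-- Weight two slash operators permute the logarithmic differentials attached to divisors of
degree zero. -/
lemma slash_logDerivRat (M : Matrix.SpecialLinearGroup (Fin 2) ℝ) (N : ℕ) {x w x' w' : ℕ → ℂ}
    (hx : ∀ i < N, den M (x' i) ≠ 0 ∧ mob M (x' i) = x i)
    (hw : ∀ i < N, den M (w' i) ≠ 0 ∧ mob M (w' i) = w i) :
    ∀ᶠ z in cofinite, slash 1 (toFun (logDerivRat N x w)) M z =
      ∑ i ∈ Finset.range N, ((z - x' i)⁻¹ - (z - w' i)⁻¹) := by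
  have hne : ∀ u : ℕ → ℂ, ∀ᶠ z in cofinite, ∀ i ∈ Finset.range N, z ≠ u i := by
    intro u
    rw [Filter.eventually_all_finset]
    intro i _
    exact (Set.finite_singleton (u i)).compl_mem_cofinite
  filter_upwards [eventually_slash_congr (toFun_logDerivRat N x w) 1 M, eventually_den_ne_zero M,
    hne x', hne w'] with z h1 h2 h3 h4
  rw [h1, slash_eq, Finset.mul_sum]
  refine Finset.sum_congr rfl fun i hi => ?_
  obtain ⟨d1, m1⟩ := hx i (Finset.mem_range.mp hi)
  obtain ⟨d2, m2⟩ := hw i (Finset.mem_range.mp hi)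
  rw [mul_sub, ← m1, ← m2, slash_inv_sub M d1 h2 (h3 i hi), slash_inv_sub M d2 h2 (h4 i hi)]
  ring

lemma sum_shift_of_periodic {p : ℕ} {g : ℕ → ℂ} (hg : ∀ m, g (m + p) = g m) (i : ℕ) :
    ∑ j ∈ Finset.range p, g (i + p - j) = ∑ j ∈ Finset.range p, g (p - j) := by
  induction i with
  | zero => simp
  | succ i ih =>
    rw [← ih]
    rcases p with _ | p
    · simp
    · rw [Finset.sum_range_succ', Finset.sum_range_succ]
      have e1 : ∀ j ∈ Finset.range p, g (i + 1 + (p + 1) - (j + 1)) = g (i + (p + 1) - j) :=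
        fun j _ => by congr 1; omega
      rw [Finset.sum_congr rfl e1]
      congr 1
      rw [Nat.sub_zero, hg, show i + (p + 1) - p = i + 1 by omega]

section

variable {p : ℕ}

/-- The divisor `∑ i, ([x i] - [T x i])` is anti-invariant under `T`, and its translates under the
powers of `U` cancel since each `x i` lies in the `U`-orbit of `T x (i + 1)`. -/
lemma isRPF_logDerivRat (hp : 3 ≤ p) {N : ℕ} {x : ℕ → ℂ} {m : ℕ → ℕ} (hpos : ∀ i, 0 < (x i).re)
    (hN : x N = x 0) (h : ∀ i, x i = mob (heckeU p ^ m i) (-1 / x (i + 1))) :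
    IsRPF p 1 (logDerivRat N x fun i => -1 / x i) := by
  have hne : ∀ i, -1 / x i ≠ 0 := fun i => neg_one_div_ne_zero (ne_zero_of_re_pos (hpos i))
  have hre : ∀ i, (-1 / x i).re ≤ 0 := fun i => (neg_one_div_re_neg (hpos i)).le
  constructor
  · filter_upwards [toFun_logDerivRat N x fun i => -1 / x i,
      slash_logDerivRat heckeT N (x := x) (w := fun i => -1 / x i) (x' := fun i => -1 / x i)
        (w' := x) (fun i _ => ⟨by simpa using hne i, by simp [neg_div]⟩)
        (fun i _ => ⟨by simpa using ne_zero_of_re_pos (hpos i), by simp⟩)] with z h1 h2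
    rw [h1, h2, ← Finset.sum_add_distrib]
    exact Finset.sum_eq_zero fun i _ => by ring
  · have key : ∀ᶠ z in cofinite, ∀ j ∈ Finset.range p,
        slash 1 (toFun (logDerivRat N x fun i => -1 / x i)) (heckeU p ^ j) z =
          ∑ i ∈ Finset.range N, ((z - mob (heckeU p ^ (m i + p - j)) (-1 / x (i + 1)))⁻¹ -
            (z - mob (heckeU p ^ (p - j)) (-1 / x i))⁻¹) := by
      rw [Filter.eventually_all_finset]
      intro j hj
      have hj := Finset.mem_range.mp hj
      refine slash_logDerivRat _ N (fun i _ => ⟨den_heckeU_pow_mob_ne_zero hp (hre _) (hne _) _ _,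
        ?_⟩) (fun i _ => ⟨den_heckeU_pow_mob_ne_zero hp (hre _) (hne _) _ _, ?_⟩)
      · rw [mob_heckeU_pow_comp hp (hre _) (hne _), show j + (m i + p - j) = m i + p by omega,
          mob_heckeU_pow_add hp, ← h i]
      · rw [mob_heckeU_pow_comp hp (hre _) (hne _), show j + (p - j) = 0 + p by omega,
          mob_heckeU_pow_add hp, pow_zero, mob_one]
    filter_upwards [key] with z hz
    rw [Finset.sum_congr rfl hz, Finset.sum_comm]
    have hg : ∀ i n, (z - mob (heckeU p ^ (n + p)) (-1 / x i))⁻¹ =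
        (z - mob (heckeU p ^ n) (-1 / x i))⁻¹ := fun i n => by rw [mob_heckeU_pow_add hp]
    have e : ∀ i ∈ Finset.range N, ∑ j ∈ Finset.range p,
        ((z - mob (heckeU p ^ (m i + p - j)) (-1 / x (i + 1)))⁻¹ -
          (z - mob (heckeU p ^ (p - j)) (-1 / x i))⁻¹) =
        ∑ j ∈ Finset.range p, (z - mob (heckeU p ^ (p - j)) (-1 / x (i + 1)))⁻¹ -
          ∑ j ∈ Finset.range p, (z - mob (heckeU p ^ (p - j)) (-1 / x i))⁻¹ := by
      intro i _
      rw [Finset.sum_sub_distrib, sum_shift_of_periodic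
        (g := fun n => (z - mob (heckeU p ^ n) (-1 / x (i + 1)))⁻¹) (hg (i + 1)) (m i)]
    rw [Finset.sum_congr rfl e, Finset.sum_range_sub
      (fun i => ∑ j ∈ Finset.range p, (z - mob (heckeU p ^ (p - j)) (-1 / x i))⁻¹), hN, sub_self]

/-- The poles attached to a code are exactly the nonzero poles of a rational period function of
weight two. -/
lemma exists_isRPF_nonzeroPoles_eq (hp : 3 ≤ p) {y : ℕ → Fin (p - 1)} (hy : y ∈ codes p) :
    ∃ q, IsRPF p 1 q ∧ nonzeroPoles q = codePoles y := by
  set N := minimalPeriod shift y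
  have hN : 0 < N := minimalPeriod_pos_of_mem_periodicPts hy.1
  let x : ℕ → ℂ := fun i => (codePoint (shift^[i] y) : ℂ)
  have hpos : ∀ i, 0 < (x i).re := fun i => by
    simpa [x] using (codePoint_spec hp (iterate_shift_mem_codes hy i)).1
  have hxN : x N = x 0 := by simp only [x, N, iterate_minimalPeriod, iterate_zero, id]
  have hrec : ∀ i, x i = mob (heckeU p ^ ((y i : ℕ) + 1)) (-1 / x (i + 1)) := by
    intro i
    have := codePoint_eq hp (iterate_shift_mem_codes hy i)
    rw [shift_iterate_apply, zero_add, ← iterate_succ_apply' shift] at this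
    rw [← mob_digitMatrix _ (ne_zero_of_re_pos (hpos _))]
    exact this
  have hmod : ∀ n, x (n % N) = x n := fun n => by
    simp only [x, N, iterate_mod_minimalPeriod_eq]
  have hinj : ∀ i < N, ∀ j < N, j ≠ i → x j ≠ x i := by
    intro i hi j hj hne h
    have h1 := codePoint_injOn hp (iterate_shift_mem_codes hy j) (iterate_shift_mem_codes hy i)
      (Complex.ofReal_injective h)
    exact hne ((iterate_eq_iterate_iff_of_lt_minimalPeriod hj hi).mp h1)
  have hsep : ∀ i j, x i ≠ -1 / x j := fun i j h => by
    have h1 := neg_one_div_re_neg (hpos j)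
    rw [← h] at h1
    linarith [hpos i]
  have hq := isRPF_logDerivRat hp hpos hxN hrec
  refine ⟨_, hq, Set.Subset.antisymm ?_ ?_⟩
  · rintro b ⟨hb0, hb⟩
    by_contra hn
    refine not_isRoot_logDerivRat (fun i _ h => hn ⟨i, Or.inl h⟩) (fun i _ h => hn ⟨i, Or.inr h⟩) hb
  · have hmem : ∀ n, x n ∈ nonzeroPoles (logDerivRat N x fun i => -1 / x i) := fun n =>
      ⟨ne_zero_of_re_pos (hpos n), isRoot_logDerivRat (Nat.mod_lt n hN) (hmod n).symm
        (fun j hj => hinj _ (Nat.mod_lt n hN) j hj) (fun j _ => hsep _ j)⟩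
    rintro b ⟨n, rfl | rfl⟩
    · exact hmem n
    · exact (mem_nonzeroPoles_neg_one_div_iff hq _).mpr (hmem n)

/-! ### Irreducible systems of poles -/

/-- Every nonzero pole of a rational period function belongs to the system of poles of some code,
and drags the whole system along. -/
lemma IsRPF.exists_code {k : ℕ} {q : RatFunc ℂ} (hp : 3 ≤ p) (hq : IsRPF p k q) {a : ℂ}
    (ha : a ∈ nonzeroPoles q) :
    ∃ y ∈ codes p, (a = codePoint y ∨ a = -1 / codePoint y) ∧ codePoles y ⊆ nonzeroPoles q := by
  have main : ∀ b ∈ nonzeroPoles q, 0 < b.re →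
      ∃ y ∈ codes p, b = codePoint y ∧ codePoles y ⊆ nonzeroPoles q := by
    intro b hb hre
    obtain ⟨y, hy, hby, h⟩ := hq.exists_code_of_re_pos hp hre hb.2
    refine ⟨y, hy, hby, ?_⟩
    rintro c ⟨n, rfl | rfl⟩
    · exact h n
    · exact (mem_nonzeroPoles_neg_one_div_iff hq _).mpr (h n)
  rcases lt_trichotomy a.re 0 with h | h | h
  · obtain ⟨y, hy, hay, hs⟩ := main (-1 / a) ((mem_nonzeroPoles_neg_one_div_iff hq a).mpr ha)
      (neg_one_div_re_pos h)
    exact ⟨y, hy, Or.inr (by rw [← hay, neg_one_div_neg_one_div]), hs⟩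
  · exact absurd h (hq.re_ne_zero hp ha.1 ha.2)
  · obtain ⟨y, hy, hay, hs⟩ := main a ha h
    exact ⟨y, hy, Or.inl hay, hs⟩

lemma codePoint_eq_of_eq_or (hp : 3 ≤ p) {y y' : ℕ → Fin (p - 1)} (hy : y ∈ codes p)
    (hy' : y' ∈ codes p) {a : ℂ} (h : a = codePoint y ∨ a = -1 / codePoint y)
    (h' : a = codePoint y' ∨ a = -1 / codePoint y') : y = y' := by
  have h1 : 0 < (codePoint y : ℂ).re := by simpa using (codePoint_spec hp hy).1
  have h1' : 0 < (codePoint y' : ℂ).re := by simpa using (codePoint_spec hp hy').1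
  have n1 := neg_one_div_re_neg h1
  have n1' := neg_one_div_re_neg h1'
  refine codePoint_injOn hp hy hy' (Complex.ofReal_injective ?_)
  rcases h with rfl | rfl <;> rcases h' with h' | h'
  · exact h'
  · rw [h'] at h1
    linarith
  · rw [h'] at n1
    linarith
  · rw [← neg_one_div_neg_one_div (codePoint y : ℂ), h', neg_one_div_neg_one_div]

lemma isISP_iff (hp : 3 ≤ p) (P : Set ℂ) : IsISP p P ↔ ∃ y ∈ codes p, P = codePoles y := by
  have main : ∀ y ∈ codes p, ∀ a : ℂ, (a = codePoint y ∨ a = -1 / codePoint y) →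
      {b : ℂ | ∀ (k : ℕ) (q : RatFunc ℂ), 0 < k → IsRPF p k q →
        a ∈ nonzeroPoles q → b ∈ nonzeroPoles q} = codePoles y := by
    intro y hy a ha
    refine Set.Subset.antisymm ?_ ?_
    · intro b hb
      obtain ⟨q, hq, hqy⟩ := exists_isRPF_nonzeroPoles_eq hp hy
      rw [← hqy]
      refine hb 1 q one_pos hq ?_
      rw [hqy]
      exact ⟨0, ha⟩
    · intro b hb k q _ hq haq
      obtain ⟨y', hy', ha', hs⟩ := hq.exists_code hp haq
      obtain rfl := codePoint_eq_of_eq_or hp hy hy' ha ha'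
      exact hs hb
  constructor
  · rintro ⟨a, ⟨k, q, hk, hq, ha⟩, rfl⟩
    obtain ⟨y, hy, hay, -⟩ := hq.exists_code hp ha
    exact ⟨y, hy, main y hy a hay⟩
  · rintro ⟨y, hy, rfl⟩
    obtain ⟨q, hq, hqy⟩ := exists_isRPF_nonzeroPoles_eq hp hy
    refine ⟨codePoint y, ⟨1, q, one_pos, hq, ?_⟩, (main y hy _ (Or.inl rfl)).symm⟩
    rw [hqy]
    exact ⟨0, Or.inl rfl⟩

lemma positivePart_codePoles (hp : 3 ≤ p) {y : ℕ → Fin (p - 1)} (hy : y ∈ codes p) :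
    positivePart (codePoles y) = codePoint '' Set.range fun n => shift^[n] y := by
  ext x
  constructor
  · rintro ⟨hx, n, h | h⟩
    · exact ⟨_, ⟨n, rfl⟩, by exact_mod_cast h.symm⟩
    · have := neg_one_div_re_neg (z := (codePoint (shift^[n] y) : ℂ))
        (by simpa using (codePoint_spec hp (iterate_shift_mem_codes hy n)).1)
      rw [← h, Complex.ofReal_re] at this
      linarith
  · rintro ⟨_, ⟨n, rfl⟩, rfl⟩
    exact ⟨(codePoint_spec hp (iterate_shift_mem_codes hy n)).1, n, Or.inl rfl⟩

lemma encard_range_iterate {A : Type*} {f : A → A} {a : A} (h : a ∈ periodicPts f) :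
    (Set.range fun n => f^[n] a).encard = minimalPeriod f a := by
  have e : (Set.range fun n => f^[n] a) = (fun n => f^[n] a) '' Set.Iio (minimalPeriod f a) := by
    refine Set.Subset.antisymm ?_ (Set.image_subset_range _ _)
    rintro _ ⟨n, rfl⟩
    exact ⟨n % minimalPeriod f a, Nat.mod_lt _ (minimalPeriod_pos_of_mem_periodicPts h),
      iterate_mod_minimalPeriod_eq⟩
  rw [e, iterate_injOn_Iio_minimalPeriod.encard_image, ← Finset.coe_range,
    Set.encard_coe_eq_coe_finsetCard, Finset.card_range]

lemma range_subset_codes {y : ℕ → Fin (p - 1)} (hy : y ∈ codes p) :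
    (Set.range fun n => shift^[n] y) ⊆ codes p := by
  rintro _ ⟨n, rfl⟩
  exact iterate_shift_mem_codes hy n

lemma encard_positivePart (hp : 3 ≤ p) {y : ℕ → Fin (p - 1)} (hy : y ∈ codes p) :
    (positivePart (codePoles y)).encard = minimalPeriod shift y := by
  rw [positivePart_codePoles hp hy,
    ((codePoint_injOn hp).mono (range_subset_codes hy)).encard_image, encard_range_iterate hy.1]

lemma ISPsWith_eq (hp : 3 ≤ p) (n : ℕ) :
    ISPsWith p n = codePoles '' {y ∈ codes p | minimalPeriod shift y = n} := by
  ext P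
  constructor
  · rintro ⟨hP, hn⟩
    obtain ⟨y, hy, rfl⟩ := (isISP_iff hp P).mp hP
    rw [encard_positivePart hp hy] at hn
    exact ⟨y, ⟨hy, by exact_mod_cast hn⟩, rfl⟩
  · rintro ⟨y, ⟨hy, hn⟩, rfl⟩
    refine ⟨(isISP_iff hp _).mpr ⟨y, hy, rfl⟩, ?_⟩
    rw [encard_positivePart hp hy, hn]

/-- Two codes have the same system of poles exactly when they lie in the same orbit of the
shift. -/
lemma codePoles_eq_iff (hp : 3 ≤ p) {y y' : ℕ → Fin (p - 1)} (hy : y ∈ codes p)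
    (hy' : y' ∈ codes p) : codePoles y = codePoles y' ↔
      (Set.range fun n => shift^[n] y) = Set.range fun n => shift^[n] y' := by
  constructor
  · intro h
    have := congrArg positivePart h
    rw [positivePart_codePoles hp hy, positivePart_codePoles hp hy'] at this
    exact ((codePoint_injOn hp).image_eq_image_iff (range_subset_codes hy)
      (range_subset_codes hy')).mp this
  · intro h
    have e : ∀ z : ℕ → Fin (p - 1), codePoles z = ⋃ u ∈ Set.range fun n => shift^[n] z,
        {(codePoint u : ℂ), -1 / (codePoint u : ℂ)} := by
      intro z
      ext b
      simp [codePoles]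
    rw [e, e, h]

end

/-! ### Primitive necklaces and periodic sequences -/

section

variable {A : Type*}

lemma isPeriodicPt_shift_iff {y : ℕ → A} {n : ℕ} :
    IsPeriodicPt shift n y ↔ ∀ i, y (i + n) = y i := by
  constructor
  · intro h i
    rw [← shift_iterate_apply y n i, h.eq]
  · intro h
    funext i
    rw [shift_iterate_apply, h]

/-- The word formed by the first `n` letters of a sequence. -/
def initialWord (n : ℕ) (y : ℕ → A) : List A := List.ofFn fun i : Fin n => y i

@[simp] lemma length_initialWord (n : ℕ) (y : ℕ → A) : (initialWord n y).length = n := by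
  simp [initialWord]

lemma initialWord_iterate_shift {y : ℕ → A} {n : ℕ} (h : IsPeriodicPt shift n y) (m : ℕ) :
    initialWord n (shift^[m] y) = (initialWord n y).rotate m := by
  refine List.ext_getElem (by simp) fun i h1 h2 => ?_
  rw [List.getElem_rotate]
  simp only [initialWord, List.getElem_ofFn, List.length_ofFn, shift_iterate_apply]
  exact (apply_mod_of_isPeriodicPt h _).symm

lemma eq_of_initialWord_eq {y y' : ℕ → A} {n : ℕ} (hn : 0 < n) (h : IsPeriodicPt shift n y)
    (h' : IsPeriodicPt shift n y') (he : initialWord n y = initialWord n y') : y = y' := by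
  have := List.ofFn_injective he
  funext i
  rw [← apply_mod_of_isPeriodicPt h, ← apply_mod_of_isPeriodicPt h']
  exact congrFun this ⟨i % n, Nat.mod_lt _ hn⟩

lemma exists_eq_initialWord {n : ℕ} (hn : 0 < n) (w : List A) (hw : w.length = n) :
    ∃ y : ℕ → A, IsPeriodicPt shift n y ∧ initialWord n y = w := by
  subst hw
  refine ⟨fun i => w[i % w.length]'(Nat.mod_lt _ hn), ?_, ?_⟩
  · rw [isPeriodicPt_shift_iff]
    intro i
    simp
  · refine List.ext_getElem (by simp) fun i h1 h2 => ?_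
    simp [initialWord, Nat.mod_eq_of_lt h2]

lemma range_iterate_eq_of_iterate_eq {f : A → A} {a b : A} (ha : a ∈ periodicPts f) {m : ℕ}
    (h : f^[m] a = b) : (Set.range fun n => f^[n] a) = Set.range fun n => f^[n] b := by
  subst h
  refine Set.Subset.antisymm ?_ ?_
  · rintro _ ⟨n, rfl⟩
    obtain ⟨N, hN, hper⟩ := ha
    refine ⟨n + (N * m - m), ?_⟩
    have hle : m ≤ N * m := Nat.le_mul_of_pos_left m hN
    change f^[n + (N * m - m)] (f^[m] a) = f^[n] a
    rw [← iterate_add_apply, show n + (N * m - m) + m = n + N * m by omega, iterate_add_apply,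
      (hper.mul_const m).eq]
  · rintro _ ⟨n, rfl⟩
    exact ⟨n + m, iterate_add_apply f n m a⟩

/-- Two sequences of period `n` have the same necklace exactly when they lie in the same orbit of
the shift. -/
lemma initialWord_cycle_eq_iff {y y' : ℕ → A} {n : ℕ} (hn : 0 < n) (h : IsPeriodicPt shift n y)
    (h' : IsPeriodicPt shift n y') :
    (initialWord n y : Cycle A) = initialWord n y' ↔
      (Set.range fun m => shift^[m] y) = Set.range fun m => shift^[m] y' := by
  rw [Cycle.coe_eq_coe]
  constructor
  · rintro ⟨m, hm⟩
    rw [← initialWord_iterate_shift h] at hm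
    exact range_iterate_eq_of_iterate_eq ⟨n, hn, h⟩
      (eq_of_initialWord_eq hn (h.apply_iterate m) h' hm)
  · intro he
    obtain ⟨m, hm⟩ : y' ∈ Set.range fun m => shift^[m] y := he ▸ ⟨0, rfl⟩
    exact ⟨m, by rw [← initialWord_iterate_shift h, ← hm]⟩

end

/-- The sequences of minimal period `n`. -/
def sequencesOfMinimalPeriod (A : Type*) (n : ℕ) : Set (ℕ → A) :=
  {y | minimalPeriod shift y = n}

section

variable {A : Type*}

lemma isPeriodicPt_of_mem {n : ℕ} {y : ℕ → A} (hy : y ∈ sequencesOfMinimalPeriod A n) :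
    IsPeriodicPt shift n y := by
  have := isPeriodicPt_minimalPeriod shift y
  rwa [show minimalPeriod shift y = n from hy] at this

lemma primitiveNecklaces_eq (q : ℕ) {n : ℕ} (hn : 0 < n) :
    primitiveNecklaces q n =
      (fun y => (initialWord n y : Cycle (Fin q))) '' sequencesOfMinimalPeriod (Fin q) n := by
  ext c
  constructor
  · rintro ⟨w, hw, hprim, rfl⟩
    obtain ⟨y, hy, rfl⟩ := exists_eq_initialWord hn w hw
    refine ⟨y, ?_, rfl⟩
    by_contra hne
    have hlt : minimalPeriod shift y < n := lt_of_le_of_ne (hy.minimalPeriod_le hn) hne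
    refine hprim _ (by simpa using hy.minimalPeriod_dvd) (by simpa using hlt) ?_
    rw [← initialWord_iterate_shift hy, iterate_minimalPeriod]
  · rintro ⟨y, hy, rfl⟩
    have hper := isPeriodicPt_of_mem hy
    refine ⟨_, length_initialWord n y, ?_, rfl⟩
    intro d hd hdn h
    rw [length_initialWord] at hd hdn
    rw [← initialWord_iterate_shift hper] at h
    have h1 : IsPeriodicPt shift d y := eq_of_initialWord_eq hn (hper.apply_iterate d) hper h
    have h2 := h1.minimalPeriod_le (Nat.pos_of_dvd_of_pos hd hn)
    rw [show minimalPeriod shift y = n from hy] at h2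
    omega

/-- Sequences of period `n` are determined by their first `n` letters, which are arbitrary. -/
noncomputable def ptsOfPeriodEquiv (A : Type*) {n : ℕ} (hn : 0 < n) :
    ptsOfPeriod (shift (A := A)) n ≃ (Fin n → A) :=
  Equiv.ofBijective (fun y i => y.1 i) <| by
    constructor
    · intro y y' h
      exact Subtype.ext (eq_of_initialWord_eq hn y.2 y'.2 (congrArg List.ofFn h))
    · intro w
      obtain ⟨y, hy, h⟩ := exists_eq_initialWord hn (List.ofFn w) (by simp)
      exact ⟨⟨y, hy⟩, List.ofFn_injective h⟩

variable [Fintype A]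

lemma finite_ptsOfPeriod {n : ℕ} (hn : 0 < n) : (ptsOfPeriod (shift (A := A)) n).Finite :=
  @Set.toFinite _ _ (Finite.of_equiv _ (ptsOfPeriodEquiv A hn).symm)

lemma finite_sequencesOfMinimalPeriod {n : ℕ} (hn : 0 < n) :
    (sequencesOfMinimalPeriod A n).Finite :=
  (finite_ptsOfPeriod hn).subset fun _ hy => isPeriodicPt_of_mem hy

lemma sum_ncard_sequencesOfMinimalPeriod {n : ℕ} (hn : 0 < n) :
    ∑ d ∈ n.divisors, (sequencesOfMinimalPeriod A d).ncard = Fintype.card A ^ n := by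
  classical
  have hcard : (finite_ptsOfPeriod (A := A) hn).toFinset.card = Fintype.card A ^ n := by
    rw [← Set.ncard_eq_toFinset_card _ (finite_ptsOfPeriod hn), ← Nat.card_coe_set_eq,
      Nat.card_congr (ptsOfPeriodEquiv A hn)]
    simp
  rw [← hcard, Finset.card_eq_sum_card_fiberwise (f := minimalPeriod shift) (t := n.divisors)]
  · refine Finset.sum_congr rfl fun d hd => ?_
    rw [← Set.ncard_coe_finset]
    congr 1
    ext y
    simp only [Finset.coe_filter, Set.Finite.mem_toFinset, mem_ptsOfPeriod]
    constructor
    · intro hy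
      exact ⟨(isPeriodicPt_of_mem hy).trans_dvd (Nat.dvd_of_mem_divisors hd), hy⟩
    · exact fun hy => hy.2
  · intro y hy
    rw [Finset.mem_coe, Set.Finite.mem_toFinset] at hy
    exact Nat.mem_divisors.mpr ⟨IsPeriodicPt.minimalPeriod_dvd hy, hn.ne'⟩

end

/-- Each primitive necklace of length `n` comes from exactly `n` sequences of minimal period
`n`. -/
lemma mul_numPrimitiveNecklaces (q : ℕ) {n : ℕ} (hn : 0 < n) :
    (sequencesOfMinimalPeriod (Fin q) n).ncard = n * numPrimitiveNecklaces q n := by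
  classical
  have hfin := finite_sequencesOfMinimalPeriod (A := Fin q) hn
  have himage := hfin.image fun y => (initialWord n y : Cycle (Fin q))
  rw [numPrimitiveNecklaces, primitiveNecklaces_eq q hn, Set.ncard_eq_toFinset_card _ hfin,
    Set.ncard_eq_toFinset_card _ himage, mul_comm,
    Finset.card_eq_sum_card_fiberwise (f := fun y => (initialWord n y : Cycle (Fin q)))
      (t := himage.toFinset)]
  · refine Finset.sum_const_nat fun c hc => ?_
    rw [Set.Finite.mem_toFinset] at hc
    obtain ⟨y, hy, rfl⟩ := hc
    have hper := isPeriodicPt_of_mem hy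
    have hmem : y ∈ periodicPts (shift (A := Fin q)) := ⟨n, hn, hper⟩
    have e : (Set.range fun m => shift^[m] y) = ((hfin.toFinset.filter fun z =>
        (initialWord n z : Cycle (Fin q)) = initialWord n y : Finset _) : Set _) := by
      ext z
      simp only [Finset.coe_filter, Set.Finite.mem_toFinset]
      constructor
      · rintro ⟨m, rfl⟩
        refine ⟨(minimalPeriod_apply_iterate hmem m).trans hy, ?_⟩
        exact (initialWord_cycle_eq_iff hn (hper.apply_iterate m) hper).mpr
          (range_iterate_eq_of_iterate_eq hmem rfl).symm
      · rintro ⟨hz, h⟩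
        rw [initialWord_cycle_eq_iff hn (isPeriodicPt_of_mem hz) hper] at h
        rw [← h]
        exact ⟨0, rfl⟩
    have h := encard_range_iterate hmem
    rw [e, Set.encard_coe_eq_coe_finsetCard, show minimalPeriod shift y = n from hy] at h
    exact_mod_cast h
  · intro y hy
    rw [Finset.mem_coe, Set.Finite.mem_toFinset] at hy ⊢
    exact ⟨y, hy, rfl⟩

lemma numPrimitiveNecklaces_eq (q : ℕ) {n : ℕ} (hn : 0 < n) :
    (numPrimitiveNecklaces q n : ℚ) =
      (1 / (n : ℚ)) * ∑ d ∈ n.divisors, (ArithmeticFunction.moebius d : ℚ) * (q : ℚ) ^ (n / d) := by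
  have hn' : (n : ℚ) ≠ 0 := by exact_mod_cast hn.ne'
  have h := (ArithmeticFunction.sum_eq_iff_sum_mul_moebius_eq (R := ℚ)
    (f := fun d => ((sequencesOfMinimalPeriod (Fin q) d).ncard : ℚ))
    (g := fun n => (q : ℚ) ^ n)).mp (fun m hm => by
      have := sum_ncard_sequencesOfMinimalPeriod (A := Fin q) hm
      rw [Fintype.card_fin] at this
      exact_mod_cast this) n hn
  rw [Nat.sum_divisorsAntidiagonal
    (fun a b => (ArithmeticFunction.moebius a : ℚ) * (q : ℚ) ^ b)] at h
  rw [h, mul_numPrimitiveNecklaces q hn]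
  push_cast
  field_simp

/-! ### Counting irreducible systems of poles -/

lemma encard_image_eq_of_iff {α β γ : Type*} {s : Set α} {f : α → β} {g : α → γ}
    (h : ∀ x ∈ s, ∀ y ∈ s, f x = f y ↔ g x = g y) : (f '' s).encard = (g '' s).encard := by
  have hf : Set.InjOn Prod.fst ((fun x => (f x, g x)) '' s) := by
    rintro _ ⟨x, hx, rfl⟩ _ ⟨y, hy, rfl⟩ hxy
    exact Prod.ext hxy ((h x hx y hy).mp hxy)
  have hg : Set.InjOn Prod.snd ((fun x => (f x, g x)) '' s) := by
    rintro _ ⟨x, hx, rfl⟩ _ ⟨y, hy, rfl⟩ hxy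
    exact Prod.ext ((h x hx y hy).mpr hxy) hxy
  rw [← Set.image_image Prod.fst (fun x => (f x, g x)), ← Set.image_image Prod.snd
    (fun x => (f x, g x)), hf.encard_image, hg.encard_image]

section

variable {p : ℕ}

lemma codes_eq_of_one_lt {n : ℕ} (hn : 1 < n) :
    {y ∈ codes p | minimalPeriod shift y = n} = sequencesOfMinimalPeriod (Fin (p - 1)) n := by
  refine Set.Subset.antisymm (fun y hy => hy.2) fun y hy => ⟨⟨⟨n, by omega,
    isPeriodicPt_of_mem hy⟩, ?_, ?_⟩, hy⟩
  all_goals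
    -- a constant sequence has minimal period one
    by_contra! h
    have h1 : IsFixedPt shift y := funext fun i => Fin.ext (by rw [shift_apply, h, h])
    have h2 := minimalPeriod_eq_one_iff_isFixedPt.mpr h1
    rw [show minimalPeriod shift y = n from hy] at h2
    omega

lemma encard_ISPsWith_of_one_lt (hp : 3 ≤ p) {n : ℕ} (hn : 1 < n) :
    (ISPsWith p n).encard = numPrimitiveNecklaces (p - 1) n := by
  have hfin : (primitiveNecklaces (p - 1) n).Finite := by
    rw [primitiveNecklaces_eq _ (by omega)]
    exact (finite_sequencesOfMinimalPeriod (by omega)).image _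
  rw [numPrimitiveNecklaces, hfin.cast_ncard_eq, primitiveNecklaces_eq _ (by omega), ISPsWith_eq hp]
  rw [← codes_eq_of_one_lt hn]
  refine encard_image_eq_of_iff fun y hy y' hy' => ?_
  rw [codePoles_eq_iff hp hy.1 hy'.1, initialWord_cycle_eq_iff (by omega)
    (isPeriodicPt_of_mem hy.2) (isPeriodicPt_of_mem hy'.2)]

lemma iterate_shift_const {A : Type*} (a : A) (n : ℕ) : shift^[n] (fun _ => a) = fun _ => a := by
  funext i
  rw [shift_iterate_apply]

lemma encard_ISPsWith_one (hp : 3 ≤ p) : (ISPsWith p 1).encard = ((p - 3 : ℕ) : ℕ∞) := by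
  classical
  let s : Finset (Fin (p - 1)) :=
    (Finset.univ.erase ⟨0, by omega⟩).erase ⟨p - 2, by omega⟩
  have hs : s.card = p - 3 := by
    rw [Finset.card_erase_of_mem, Finset.card_erase_of_mem (Finset.mem_univ _), Finset.card_univ,
      Fintype.card_fin]
    · omega
    · simp [Fin.ext_iff]
      omega
  have hmem : ∀ i ∈ s, (fun _ => i : ℕ → Fin (p - 1)) ∈ codes p := by
    intro i hi
    simp only [s, Finset.mem_erase, Fin.ext_iff, ne_eq] at hi
    exact ⟨⟨1, one_pos, iterate_shift_const i 1⟩, ⟨0, hi.2.1⟩, ⟨0, hi.1⟩⟩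
  have e : {y ∈ codes p | minimalPeriod shift y = 1} =
      (fun i _ => i) '' (s : Set (Fin (p - 1))) := by
    ext y
    constructor
    · rintro ⟨⟨-, ⟨m, hm⟩, ⟨m', hm'⟩⟩, h1⟩
      have hfix := minimalPeriod_eq_one_iff_isFixedPt.mp h1
      have hc : ∀ i, y i = y 0 := by
        intro i
        induction i with
        | zero => rfl
        | succ i ih =>
          rw [← ih]
          exact congrFun hfix.eq i
      refine ⟨y 0, ?_, funext fun i => (hc i).symm⟩
      rw [hc] at hm hm'
      simp [s, Fin.ext_iff, hm, hm']
    · rintro ⟨i, hi, rfl⟩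
      exact ⟨hmem i hi, minimalPeriod_eq_one_iff_isFixedPt.mpr (iterate_shift_const i 1)⟩
  rw [ISPsWith_eq hp, e, Set.image_image, Set.InjOn.encard_image, Set.encard_coe_eq_coe_finsetCard,
    hs]
  intro i hi j hj h
  rw [codePoles_eq_iff hp (hmem i hi) (hmem j hj)] at h
  simp only [iterate_shift_const, Set.range_const, Set.singleton_eq_singleton_iff] at h
  exact congrFun h 0

end

end HeckeRPF

theorem corollary3p6 (p : ℕ) (hp : 3 ≤ p) :
    (HeckeRPF.ISPsWith p 1).encard = ((p - 3 : ℕ) : ℕ∞) ∧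
    ∀ n : ℕ, 1 < n →
      (HeckeRPF.ISPsWith p n).encard = (HeckeRPF.numPrimitiveNecklaces (p - 1) n : ℕ∞) ∧
      (HeckeRPF.numPrimitiveNecklaces (p - 1) n : ℚ) =
        (1 / (n : ℚ)) *
          ∑ d ∈ n.divisors, (ArithmeticFunction.moebius d : ℚ) * ((p : ℚ) - 1) ^ (n / d) := by
  refine ⟨HeckeRPF.encard_ISPsWith_one hp, fun n hn =>
    ⟨HeckeRPF.encard_ISPsWith_of_one_lt hp hn, ?_⟩⟩
  rw [HeckeRPF.numPrimitiveNecklaces_eq (p - 1) (by omega), Nat.cast_sub (by omega), Nat.cast_one]
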